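/- Let $d\ge 1$ be an integer, $\beta\ge 0$ and $h\in\mathbb R$, and put $\beta_c=\frac1{2d}$. For $n\ge1$ let $\varepsilon=(\varepsilon_1,\dots,\varepsilon_n)$ be the vector of spins of the Curie--Weiss model, i.e. for $\sigma\in\{-1,1\}^n$ \[P(\varepsilon=\sigma)=\frac{1}{Z_{d,\beta,h}}\exp\Big\{\frac{d\beta}{n}\Big(\sum_{j=1}^n\sigma_j\Big)^2+h\sum_{j=1}^n\sigma_j\Big\},\] where $Z_{d,\beta,h}$ is the normalizing constant. For odd $n$ let \[P_n=P\Big(\sum_{i=1}^{(n-1)/2}\varepsilon_i-\sum_{i=(n+1)/2}^{n}\varepsilon_i=1\Big).\] Then, as $n\to\infty$ along the odd integers, with $d,\beta,h$ fixed: (1) If $h=0$ and $\beta<\beta_c$, then $P_n=\sqrt{\frac2\pi}\,n^{-1/2}+O(n^{-3/2})$. (2) If $h=0$ and $\beta=\beta_c$, then $P_n=\sqrt{\frac2\pi}\,n^{-1/2}+\frac{2\sqrt3\sqrt\pi}{\Gamma(1/4)^2}\,n^{-1}+o(n^{-1})$. (3) If $h=0$ and $\beta>\beta_c$, then the equation $\tanh\big(\frac{\beta}{\beta_c}z\big)=z$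 has a maximal real solution $z_*$, and with $t_*=2d\beta z_*$ we have $P_n=\sqrt{\frac2\pi}\cosh(t_*)\,n^{-1/2}+O(n^{-3/2})$. (4) If $h\ne0$, then the equation $\tanh\big(\frac{\beta}{\beta_c}z+|h|\big)=z$ has a maximal real solution $z_*$, and with $t_*=2d\beta z_*+|h|$ we have $P_n=\sqrt{\frac2\pi}\cosh(t_*)\,n^{-1/2}+O(n^{-3/2})$. -/

import Mathlib

open Filter Asymptotics
open scoped Topology

noncomputable section

namespace CurieWeiss

/-- Spin configurations in `{-1, 1}ⁿ`: the units of `ℤ` are exactly `1` and `-1`. -/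
abbrev Config (n : ℕ) : Type := Fin n → ℤˣ

/-- The value `-1` or `1` of the spin at site `i`, as a real number. -/
def spin {n : ℕ} (σ : Config n) (i : Fin n) : ℝ := ((σ i : ℤ) : ℝ)

/-- The unnormalized weight `exp (dβ/n (∑ σ_j)² + h ∑ σ_j)`. -/
def weight (d : ℕ) (β h : ℝ) {n : ℕ} (σ : Config n) : ℝ :=
  Real.exp ((d : ℝ) * β / (n : ℝ) * (∑ j, spin σ j) ^ 2 + h * ∑ j, spin σ j)

/-- The normalizing constant. -/
def partitionFunction (d : ℕ) (β h : ℝ) (n : ℕ) : ℝ :=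
  ∑ σ : Config n, weight d β h σ

/-- The Curie-Weiss probability of the configuration `σ`. -/
def prob (d : ℕ) (β h : ℝ) {n : ℕ} (σ : Config n) : ℝ :=
  weight d β h σ / partitionFunction d β h n

theorem partitionFunction_pos (d : ℕ) (β h : ℝ) (n : ℕ) : 0 < partitionFunction d β h n :=
  Finset.sum_pos (fun _ _ => Real.exp_pos _) Finset.univ_nonempty

theorem prob_pos (d : ℕ) (β h : ℝ) {n : ℕ} (σ : Config n) : 0 < prob d β h σ :=
  div_pos (Real.exp_pos _) (partitionFunction_pos d β h n)

theorem sum_prob (d : ℕ) (β h : ℝ) (n : ℕ) : ∑ σ : Config n, prob d β h σ = 1 := by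
  unfold prob
  rw [← Finset.sum_div]
  exact div_self (partitionFunction_pos d β h n).ne'

open Classical in
/-- The Curie-Weiss probability of an event. -/
def eventProb (d : ℕ) (β h : ℝ) {n : ℕ} (A : Set (Config n)) : ℝ :=
  ∑ σ : Config n with σ ∈ A, prob d β h σ

/-- `∑_{i=1}^{(n-1)/2} σ_i - ∑_{i=(n+1)/2}^{n} σ_i`, used for odd `n`.
The element `i : Fin n` stands for the site number `i + 1`. -/
def signedSum {n : ℕ} (σ : Config n) : ℝ :=
  (∑ i : Fin n with i.val + 1 ≤ (n - 1) / 2, spin σ i) -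
    ∑ i : Fin n with (n + 1) / 2 ≤ i.val + 1, spin σ i

/-- The probability `P_n` that the signed sum is equal to `1`. -/
def P (d : ℕ) (β h : ℝ) (n : ℕ) : ℝ :=
  eventProb d β h {σ : Config n | signedSum σ = 1}

/-- The critical inverse temperature. -/
def βc (d : ℕ) : ℝ := 1 / (2 * (d : ℝ))

/-- `n → ∞` along the odd integers. -/
def oddAtTop : Filter ℕ := atTop ⊓ 𝓟 {n : ℕ | Odd n}

end CurieWeiss

end

/-!
Write `b = 2dβ`. For `b > 0` the Hubbard-Stratonovich transformation (`sum_weight_eq`) makes the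
Curie-Weiss model a mixture of models with independent spins in an external field `t`, the mixing
density being proportional to `exp (-n * rate b h t)` with
`rate b h t = (t - h)² / (2b) - log (cosh t)`. For independent spins the probability that the signed
sum equals `1` is an explicit Fourier integral `spinProb m t`, `n = 2m + 1`
(`sum_exp_signedSum`), hence `P_n` is the mean of `spinProb m` under the mixing density
(`P_eq_gibbsMean`). If `β = 0` there is nothing to mix: `P_n = spinProb m h`.

Comparing the Fourier integrand with a Gaussian gives a local limit theorem
`spinProb m t = √(2/π) cosh t n^(-1/2) + O(exp (3|t|) n^(-3/2))`, uniformly in `t`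
(`exists_abs_spinProb_sub_le`), so that only the mean of `cosh` under the mixing density is left.

Away from criticality the rate function has nondegenerate minima, at `0` or at `±a`, where `a`
solves `(a - h) / b = tanh a`; that these are the global minima follows from the concavity of
`log (cosh √u)` in `u` (`exists_log_cosh_le_parabola`). The mean of `cosh` is then
`cosh a + O(1/n)` (`QuadraticWell.exists_abs_gibbsMean_sub_le`): the first-order term of
`cosh t - cosh a` is a multiple of the derivative of the rate function, possibly times `t`, whose
mean is `O(1/n)` by an integration by parts, and the remainder is dominated by the rate function
itself.
A negative field is reduced to `|h|` by the reflection `t ↦ -t`, which preserves `cosh`.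

At criticality `rate 1 0 t` behaves like `t⁴ / 12`. On the scale `t = n^(-1/4) y` dominated
convergence shows that `√n` times the mean of `cosh - 1` tends to half of the second moment of the
density proportional to `exp (-y⁴ / 12)`, a quotient of Gamma values that the reflection formula
turns into the stated constant.
-/

namespace CurieWeiss

/-! ### Inequalities for hyperbolic functions -/

theorem le_of_hasDerivAt_nonneg {f f' : ℝ → ℝ} {x y : ℝ} (hxy : x ≤ y)
    (hf : ∀ z ∈ Set.Icc x y, HasDerivAt f (f' z) z) (h : ∀ z ∈ Set.Icc x y, 0 ≤ f' z) :
    f x ≤ f y := by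
  refine monotoneOn_of_hasDerivWithinAt_nonneg (f' := f') (convex_Icc x y)
    (fun z hz => (hf z hz).continuousAt.continuousWithinAt)
    (fun z hz => (hf z (interior_subset hz)).hasDerivWithinAt)
    (fun z hz => h z (interior_subset hz)) ⟨le_rfl, hxy⟩ ⟨hxy, le_rfl⟩ hxy

theorem hasDerivAt_tanh (t : ℝ) : HasDerivAt Real.tanh (1 - Real.tanh t ^ 2) t := by
  have hc := (Real.cosh_pos t).ne'
  have h := (Real.hasDerivAt_sinh t).div (Real.hasDerivAt_cosh t) hc
  have e : Real.tanh = Real.sinh / Real.cosh := by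
    ext x; simp [Real.tanh_eq_sinh_div_cosh]
  have e2 : 1 - Real.tanh t ^ 2 = (Real.cosh t * Real.cosh t - Real.sinh t * Real.sinh t)
      / Real.cosh t ^ 2 := by
    rw [Real.tanh_eq_sinh_div_cosh]
    field_simp
  rw [e2, e]
  exact h

theorem hasDerivAt_log_cosh (t : ℝ) :
    HasDerivAt (fun t => Real.log (Real.cosh t)) (Real.tanh t) t := by
  simpa [Real.tanh_eq_sinh_div_cosh] using (Real.hasDerivAt_cosh t).log (Real.cosh_pos t).ne'

theorem continuous_tanh : Continuous Real.tanh :=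
  continuous_iff_continuousAt.2 fun t => (hasDerivAt_tanh t).continuousAt

theorem one_sub_tanh_sq_pos (t : ℝ) : 0 < 1 - Real.tanh t ^ 2 := by
  linarith [Real.tanh_sq_lt_one t]

theorem tanh_mono : Monotone Real.tanh :=
  fun _ _ hxy => le_of_hasDerivAt_nonneg hxy (fun z _ => hasDerivAt_tanh z)
    (fun z _ => (one_sub_tanh_sq_pos z).le)

theorem tanh_nonneg {t : ℝ} (ht : 0 ≤ t) : 0 ≤ Real.tanh t := by
  simpa using tanh_mono ht

theorem tanh_le_self {t : ℝ} (ht : 0 ≤ t) : Real.tanh t ≤ t := by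
  have h := le_of_hasDerivAt_nonneg (f := fun t => t - Real.tanh t) ht
    (fun z _ => (hasDerivAt_id z).sub (hasDerivAt_tanh z)) (fun z _ => by nlinarith)
  simpa using h

theorem self_sub_cube_le_tanh {t : ℝ} (ht : 0 ≤ t) : t - t ^ 3 / 3 ≤ Real.tanh t := by
  have h := le_of_hasDerivAt_nonneg (f := fun t => Real.tanh t - (t - t ^ 3 / 3)) ht
    (fun z _ => (hasDerivAt_tanh z).sub ((hasDerivAt_id z).sub ((hasDerivAt_pow 3 z).div_const 3)))
    (fun z hz => by
      have h1 := tanh_le_self hz.1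
      have h2 := tanh_nonneg hz.1
      norm_num
      nlinarith)
  simp at h
  linarith

theorem abs_tanh_sub_le (s t : ℝ) : |Real.tanh s - Real.tanh t| ≤ |s - t| := by
  wlog h : t ≤ s generalizing s t
  · rw [abs_sub_comm, abs_sub_comm s]
    exact this t s (le_of_not_ge h)
  rw [abs_of_nonneg (sub_nonneg.2 (tanh_mono h)), abs_of_nonneg (sub_nonneg.2 h)]
  have h1 := le_of_hasDerivAt_nonneg (f := fun t => t - Real.tanh t) h
    (fun z _ => (hasDerivAt_id z).sub (hasDerivAt_tanh z)) (fun z _ => by nlinarith)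
  linarith

/-- A quadratic Taylor bound in terms of a Lipschitz-type bound on the derivative. -/
theorem abs_sub_linear_le {f f' : ℝ → ℝ} (hf : ∀ t, HasDerivAt f (f' t) t) {a t M : ℝ}
    (hM : ∀ s ∈ Set.uIcc a t, |f' s - f' a| ≤ M * |s - a|) (hM0 : 0 ≤ M) :
    |f t - f a - f' a * (t - a)| ≤ M * (t - a) ^ 2 := by
  have h := (convex_uIcc a t).norm_image_sub_le_of_norm_hasDerivWithin_le
    (f := fun s => f s - f' a * s) (f' := fun s => f' s - f' a) (C := M * |t - a|)
    (fun s _ => by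
      simpa using ((hf s).fun_sub ((hasDerivAt_id s).const_mul (f' a))).hasDerivWithinAt)
    (fun s hs => by
      rw [Real.norm_eq_abs]
      refine (hM s hs).trans (mul_le_mul_of_nonneg_left ?_ hM0)
      exact Set.abs_sub_left_of_mem_uIcc hs)
    Set.left_mem_uIcc Set.right_mem_uIcc
  simp only [Real.norm_eq_abs] at h
  calc |f t - f a - f' a * (t - a)| = |f t - f' a * t - (f a - f' a * a)| := by congr 1; ring
    _ ≤ M * |t - a| * |t - a| := h
    _ = M * (t - a) ^ 2 := by rw [mul_assoc, abs_mul_abs_self]; ring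

theorem abs_tanh_taylor (a t : ℝ) :
    |Real.tanh t - Real.tanh a - (1 - Real.tanh a ^ 2) * (t - a)| ≤ 2 * (t - a) ^ 2 := by
  refine abs_sub_linear_le hasDerivAt_tanh (fun s _ => ?_) (by norm_num)
  have e : (1 - Real.tanh s ^ 2) - (1 - Real.tanh a ^ 2)
      = -((Real.tanh s - Real.tanh a) * (Real.tanh s + Real.tanh a)) := by ring
  rw [e, abs_neg, abs_mul, mul_comm]
  refine mul_le_mul ?_ (abs_tanh_sub_le s a) (abs_nonneg _) (by norm_num)
  refine (abs_add_le _ _).trans ?_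
  linarith [Real.abs_tanh_lt_one s, Real.abs_tanh_lt_one a]

theorem cosh_le_exp_abs (t : ℝ) : Real.cosh t ≤ Real.exp |t| := by
  rw [← Real.cosh_abs, Real.cosh_eq]
  have : Real.exp (-|t|) ≤ Real.exp |t| := Real.exp_le_exp.2 (by linarith [abs_nonneg t])
  linarith

theorem abs_sinh_sub_le {s t R : ℝ} (hs : |s| ≤ R) (ht : |t| ≤ R) :
    |Real.sinh s - Real.sinh t| ≤ Real.exp R * |s - t| := by
  have h := (convex_Icc (-R) R).norm_image_sub_le_of_norm_hasDerivWithin_le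
    (f := Real.sinh) (f' := Real.cosh) (C := Real.exp R)
    (fun s _ => (Real.hasDerivAt_sinh s).hasDerivWithinAt)
    (fun s hs => by
      rw [Real.norm_eq_abs, abs_of_pos (Real.cosh_pos s)]
      exact (cosh_le_exp_abs s).trans (Real.exp_le_exp.2 (abs_le.2 hs)))
    (abs_le.1 ht) (abs_le.1 hs)
  simpa using h

theorem abs_cosh_taylor (a t : ℝ) :
    |Real.cosh t - Real.cosh a - Real.sinh a * (t - a)|
      ≤ Real.exp |a| * Real.exp |t| * (t - a) ^ 2 := by
  refine abs_sub_linear_le Real.hasDerivAt_cosh (fun s hs => ?_) (by positivity)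
  rw [← Real.exp_add]
  refine abs_sinh_sub_le ?_ (by linarith [abs_nonneg t])
  have h1 : |s| ≤ max |a| |t| := by
    rcases Set.mem_uIcc.1 hs with h | h
    · exact abs_le_max_abs_abs h.1 h.2
    · rw [max_comm]; exact abs_le_max_abs_abs h.1 h.2
  exact h1.trans (max_le (by linarith [abs_nonneg t]) (by linarith [abs_nonneg a]))

theorem log_cosh_tangent_le (a t : ℝ) :
    Real.log (Real.cosh a) + Real.tanh a * (t - a) ≤ Real.log (Real.cosh t) := by
  have hd : ∀ z, HasDerivAt (fun z => Real.log (Real.cosh z) - Real.tanh a * z)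
      (Real.tanh z - Real.tanh a) z := fun z => by
    simpa using (hasDerivAt_log_cosh z).fun_sub ((hasDerivAt_id z).const_mul (Real.tanh a))
  rcases le_total a t with h | h
  · have := le_of_hasDerivAt_nonneg h (fun z _ => hd z)
      (fun z hz => sub_nonneg.2 (tanh_mono hz.1))
    linarith
  · have := le_of_hasDerivAt_nonneg h (fun z _ => (hd z).neg)
      (fun z hz => by linarith [tanh_mono hz.2])
    simp only [Pi.neg_apply] at this
    linarith

theorem sq_div_two_sub_le_log_cosh (t : ℝ) :
    t ^ 2 / 2 - t ^ 4 / 12 ≤ Real.log (Real.cosh t) := by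
  wlog ht : 0 ≤ t generalizing t
  · have := this (-t) (by linarith)
    simpa [Even.neg_pow (by decide : Even 4)] using this
  have h := le_of_hasDerivAt_nonneg
    (f := fun t => Real.log (Real.cosh t) - (t ^ 2 / 2 - t ^ 4 / 12)) ht
    (fun z _ => (hasDerivAt_log_cosh z).sub
      (((hasDerivAt_pow 2 z).div_const 2).sub ((hasDerivAt_pow 4 z).div_const 12)))
    (fun z hz => by
      have := self_sub_cube_le_tanh hz.1
      norm_num
      linarith)
  simp at h
  linarith

theorem sinh_le_mul_cosh {t : ℝ} (ht : 0 ≤ t) : Real.sinh t ≤ t * Real.cosh t := by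
  have := tanh_le_self ht
  rwa [Real.tanh_eq_sinh_div_cosh, div_le_iff₀ (Real.cosh_pos t)] at this

/-- A rational upper bound for `tanh` with the correct cubic term at `0`; it keeps the quartic
growth of the critical rate function visible on the whole line. -/
theorem tanh_le_sub_cube_div {t : ℝ} (ht : 0 ≤ t) :
    Real.tanh t ≤ t - t ^ 3 / (3 * (1 + t ^ 2)) := by
  have h := le_of_hasDerivAt_nonneg
    (f := fun t => (3 * t + 2 * t ^ 3) * Real.cosh t - (3 + 3 * t ^ 2) * Real.sinh t) ht
    (fun z _ => ((((hasDerivAt_id z).const_mul 3).add ((hasDerivAt_pow 3 z).const_mul 2)).mul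
        (Real.hasDerivAt_cosh z)).sub
      (((hasDerivAt_const z (3 : ℝ)).add ((hasDerivAt_pow 2 z).const_mul 3)).mul
        (Real.hasDerivAt_sinh z)))
    (fun z hz => by
      have h1 := sinh_le_mul_cosh hz.1
      have h2 := Real.sinh_nonneg_iff.2 hz.1
      have h3 := Real.cosh_pos z
      have h4 : 0 ≤ z := hz.1
      norm_num
      have : 0 ≤ z * (z * Real.cosh z - Real.sinh z) := mul_nonneg h4 (by linarith)
      have : 0 ≤ z ^ 3 * Real.sinh z := by positivity
      nlinarith)
  simp at h
  rw [Real.tanh_eq_sinh_div_cosh, div_le_iff₀ (Real.cosh_pos t)]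
  have e : t - t ^ 3 / (3 * (1 + t ^ 2)) = (3 * t + 2 * t ^ 3) / (3 + 3 * t ^ 2) := by
    field_simp; ring
  rw [e, div_mul_eq_mul_div, le_div_iff₀ (by positivity)]
  linarith

theorem log_cosh_le_sq_div_two_sub (t : ℝ) :
    Real.log (Real.cosh t) ≤ t ^ 2 / 2 - t ^ 4 / (12 * (1 + t ^ 2)) := by
  wlog ht : 0 ≤ t generalizing t
  · have := this (-t) (by linarith)
    simpa [Even.neg_pow (by decide : Even 4)] using this
  have h := le_of_hasDerivAt_nonneg
    (f := fun t => t ^ 2 / 2 - t ^ 4 / (12 * (1 + t ^ 2)) - Real.log (Real.cosh t)) ht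
    (fun z _ => ((((hasDerivAt_pow 2 z).div_const 2).sub ((hasDerivAt_pow 4 z).div
      (((hasDerivAt_const z (1 : ℝ)).add (hasDerivAt_pow 2 z)).const_mul 12)
        (by simp only [Pi.add_apply]; positivity))).sub (hasDerivAt_log_cosh z)))
    (fun z hz => by
      have h1 := tanh_le_sub_cube_div hz.1
      have h4 : 0 ≤ z := hz.1
      norm_num
      have : (4 * z ^ 3 * (12 * (1 + z ^ 2)) - z ^ 4 * (12 * (2 * z))) / (12 * (1 + z ^ 2)) ^ 2
          ≤ z ^ 3 / (3 * (1 + z ^ 2)) := by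
        rw [div_le_div_iff₀ (by positivity) (by positivity)]
        have : 0 ≤ z ^ 5 := by positivity
        have : 0 ≤ z ^ 7 := by positivity
        nlinarith
      linarith)
  simp at h
  linarith

theorem mul_sech_sq_lt_tanh {t : ℝ} (ht : 0 < t) :
    t * (1 - Real.tanh t ^ 2) < Real.tanh t := by
  have hc := Real.cosh_pos t
  have h1 : t < Real.sinh t := Real.self_lt_sinh_iff.2 ht
  have e : 1 - Real.tanh t ^ 2 = 1 / Real.cosh t ^ 2 := by
    rw [Real.tanh_eq_sinh_div_cosh]
    field_simp
    linarith [Real.cosh_sq t]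
  rw [e, Real.tanh_eq_sinh_div_cosh, mul_one_div, div_lt_div_iff₀ (by positivity) hc]
  nlinarith [Real.one_le_cosh t, mul_pos (ht.trans h1) hc]

/-- Quantitative form of the strict decrease of `tanh t / t` on `(0, a]`. -/
theorem tanh_lower_of_le {a t : ℝ} (ht : 0 ≤ t) (hta : t ≤ a) :
    t * Real.tanh a / a + (1 - Real.tanh a ^ 2) ^ 2 / 3 * (t * (a ^ 2 - t ^ 2)) ≤ Real.tanh t := by
  rcases ht.eq_or_lt with rfl | ht
  · simp
  set s := 1 - Real.tanh a ^ 2 with hs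
  have hs0 : 0 < s := one_sub_tanh_sq_pos a
  have hM : ∀ x, 0 ≤ x → x ≤ a →
      2 / 3 * s ^ 2 * x ^ 3 ≤ Real.tanh x - x * (1 - Real.tanh x ^ 2) := by
    intro x hx hxa
    have h := le_of_hasDerivAt_nonneg
      (f := fun x => Real.tanh x - x * (1 - Real.tanh x ^ 2) - 2 / 3 * s ^ 2 * x ^ 3) hx
      (fun z _ => ((hasDerivAt_tanh z).sub ((hasDerivAt_id z).mul
        ((hasDerivAt_const z (1 : ℝ)).sub ((hasDerivAt_tanh z).pow 2)))).sub
          ((hasDerivAt_pow 3 z).const_mul (2 / 3 * s ^ 2)))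
      (fun z hz => by
        have hz0 : 0 ≤ z := hz.1
        have hsz : s ≤ 1 - Real.tanh z ^ 2 := by
          have := tanh_mono (hz.2.trans hxa)
          have := tanh_nonneg hz0
          simp only [hs]; nlinarith
        have h1 : z * s ≤ Real.tanh z := by
          rcases hz0.eq_or_lt with h | h
          · simp [← h]
          · nlinarith [mul_sech_sq_lt_tanh h]
        have h2 : z * (z * s * s) ≤ z * (Real.tanh z * (1 - Real.tanh z ^ 2)) :=
          mul_le_mul_of_nonneg_left (mul_le_mul h1 hsz hs0.le (tanh_nonneg hz0)) hz0
        norm_num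
        nlinarith)
    simp at h
    linarith
  have h := le_of_hasDerivAt_nonneg
    (f := fun x => -(Real.tanh x / x + s ^ 2 / 3 * x ^ 2)) hta
    (fun z hz => (((hasDerivAt_tanh z).div (hasDerivAt_id z) (ht.trans_le hz.1).ne').add
      ((hasDerivAt_pow 2 z).const_mul (s ^ 2 / 3))).neg)
    (fun z hz => by
      have hz0 : 0 < z := ht.trans_le hz.1
      have := hM z hz0.le hz.2
      have : ((1 - Real.tanh z ^ 2) * z - Real.tanh z) / z ^ 2 ≤ - (2 / 3 * s ^ 2 * z) := by
        rw [div_le_iff₀ (by positivity)]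
        nlinarith
      norm_num
      linarith)
  have h2 : Real.tanh a / a + s ^ 2 / 3 * (a ^ 2 - t ^ 2) ≤ Real.tanh t / t := by linarith
  rw [le_div_iff₀ ht] at h2
  calc _ = (Real.tanh a / a + s ^ 2 / 3 * (a ^ 2 - t ^ 2)) * t := by ring
    _ ≤ _ := h2

/-- `log (cosh √u)` is strictly concave in `u`: the graph stays below the tangent parabola at `±a`,
by an amount that is at least quadratic in the distance to `{a, -a}`. -/
theorem exists_log_cosh_le_parabola {a : ℝ} (ha : 0 < a) :
    ∃ c > 0, ∀ t, Real.log (Real.cosh t) + c * (|t| - a) ^ 2 ≤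
      Real.log (Real.cosh a) + Real.tanh a / a * ((t ^ 2 - a ^ 2) / 2) := by
  set τ := Real.tanh a with hτ
  set s := 1 - τ ^ 2 with hs
  have hs0 : 0 < s := one_sub_tanh_sq_pos a
  set k := τ / a - s with hk
  have hk0 : 0 < k := by
    have := mul_sech_sq_lt_tanh ha
    rw [hk, sub_pos, lt_div_iff₀ ha, mul_comm]
    exact this
  -- the first constant serves `[0, a]`, where `tanh_lower_of_le` applies, the second `[a, ∞)`,
  -- where the difference is convex with second derivative at least `k`
  refine ⟨min (s ^ 2 / 12 * a ^ 2) (k / 2), by positivity, fun t => ?_⟩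
  wlog ht : 0 ≤ t generalizing t
  · have := this (-t) (by linarith)
    simpa using this
  rw [abs_of_nonneg ht]
  rcases le_total t a with hta | hta
  · have h := le_of_hasDerivAt_nonneg
      (f := fun x => Real.log (Real.cosh x) - τ / a * ((x ^ 2 - a ^ 2) / 2)
        + s ^ 2 / 12 * (a ^ 2 - x ^ 2) ^ 2) hta
      (fun z _ => ((hasDerivAt_log_cosh z).sub
        ((((hasDerivAt_pow 2 z).sub_const (a ^ 2)).div_const 2).const_mul (τ / a))).add
        ((((hasDerivAt_pow 2 z).const_sub (a ^ 2)).pow 2).const_mul (s ^ 2 / 12)))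
      (fun z hz => by
        have h0 := tanh_lower_of_le (ht.trans hz.1) hz.2
        rw [← hτ, ← hs] at h0
        have e : z * τ / a = τ / a * z := by ring
        norm_num
        nlinarith)
    simp only [sub_self] at h
    have h2 : min (s ^ 2 / 12 * a ^ 2) (k / 2) * (t - a) ^ 2
        ≤ s ^ 2 / 12 * (a ^ 2 - t ^ 2) ^ 2 := by
      refine (mul_le_mul_of_nonneg_right (min_le_left _ _) (sq_nonneg _)).trans ?_
      rw [mul_assoc]
      refine mul_le_mul_of_nonneg_left ?_ (by positivity)
      rw [← mul_pow, sq_le_sq]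
      rw [abs_of_nonpos (by nlinarith), abs_of_nonneg (by nlinarith)]
      nlinarith
    nlinarith
  · have hN : ∀ z, a ≤ z → k * (z - a) ≤ τ / a * z - Real.tanh z := by
      intro z hz
      have h := le_of_hasDerivAt_nonneg
        (f := fun z => τ / a * z - Real.tanh z - k * (z - a)) hz
        (fun z _ => (((hasDerivAt_id z).const_mul (τ / a)).sub (hasDerivAt_tanh z)).sub
          (((hasDerivAt_id z).sub_const a).const_mul k))
        (fun z hz => by
          have h1 := tanh_mono hz.1
          have h2 := tanh_nonneg ha.le
          simp only [hk, hs, hτ, mul_one] at *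
          nlinarith)
      have e : τ / a * a = τ := div_mul_cancel₀ _ ha.ne'
      simp only [e] at h
      rw [← hτ] at h
      linarith
    have h := le_of_hasDerivAt_nonneg
      (f := fun x => τ / a * ((x ^ 2 - a ^ 2) / 2) - Real.log (Real.cosh x)
        - k / 2 * (x - a) ^ 2) hta
      (fun z _ => (((((hasDerivAt_pow 2 z).sub_const (a ^ 2)).div_const 2).const_mul (τ / a)).sub
        (hasDerivAt_log_cosh z)).sub ((((hasDerivAt_id z).sub_const a).pow 2).const_mul (k / 2)))
      (fun z hz => by
        have h0 := hN z hz.1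
        norm_num
        linarith)
    simp only [sub_self] at h
    have h2 : min (s ^ 2 / 12 * a ^ 2) (k / 2) * (t - a) ^ 2 ≤ k / 2 * (t - a) ^ 2 :=
      mul_le_mul_of_nonneg_right (min_le_right _ _) (sq_nonneg _)
    nlinarith

/-! ### Laplace's method with an error term of order `1 / n` -/

/-- The mean of `g` under the probability measure on `ℝ` with density proportional to
`exp (-n f)`. -/
noncomputable def gibbsMean (f : ℝ → ℝ) (n : ℕ) (g : ℝ → ℝ) : ℝ :=
  (∫ t, g t * Real.exp (-(n * f t))) / ∫ t, Real.exp (-(n * f t))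

theorem gibbsMean_sub_const (f : ℝ → ℝ) (n : ℕ) (g : ℝ → ℝ) (x : ℝ) :
    gibbsMean (fun t => f t - x) n g = gibbsMean f n g := by
  have e : ∀ t, Real.exp (-(n * (f t - x))) = Real.exp (n * x) * Real.exp (-(n * f t)) := by
    intro t
    rw [← Real.exp_add]
    congr 1; ring
  have e2 : ∀ t, g t * (Real.exp (n * x) * Real.exp (-(n * f t)))
      = Real.exp (n * x) * (g t * Real.exp (-(n * f t))) := fun t => by ring
  simp only [gibbsMean, e, e2, MeasureTheory.integral_const_mul]
  exact mul_div_mul_left _ _ (Real.exp_pos _).ne'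

theorem integrable_gaussian_shift {k : ℝ} (hk : 0 < k) (a : ℝ) :
    MeasureTheory.Integrable fun t : ℝ => Real.exp (-k * (t - a) ^ 2) :=
  (integrable_exp_neg_mul_sq hk).comp_sub_right a

theorem integral_gaussian_shift (k a : ℝ) :
    ∫ t : ℝ, Real.exp (-k * (t - a) ^ 2) = √(Real.pi / k) := by
  rw [MeasureTheory.integral_sub_right_eq_self (fun t : ℝ => Real.exp (-k * t ^ 2)) a,
    integral_gaussian]

theorem exp_neg_sq_abs_sub_le (k a t : ℝ) :
    Real.exp (-k * (|t| - a) ^ 2)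
      ≤ Real.exp (-k * (t - a) ^ 2) + Real.exp (-k * (t - -a) ^ 2) := by
  rcases abs_choice t with h | h
  · rw [h]; linarith [Real.exp_pos (-k * (t - -a) ^ 2)]
  · rw [h, show (-t - a) ^ 2 = (t - -a) ^ 2 by ring]; linarith [Real.exp_pos (-k * (t - a) ^ 2)]

theorem mul_exp_neg_le {x : ℝ} : x * Real.exp (-x) ≤ 2 * Real.exp (-(x / 2)) := by
  have h1 : x / 2 + 1 ≤ Real.exp (x / 2) := Real.add_one_le_exp _
  have e : Real.exp (-x) = Real.exp (-(x / 2)) * Real.exp (-(x / 2)) := by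
    rw [← Real.exp_add]; congr 1; ring
  have h2 : Real.exp (x / 2) * Real.exp (-(x / 2)) = 1 := by
    rw [← Real.exp_add]; simp
  have h3 := Real.exp_pos (-(x / 2))
  rw [e, ← mul_assoc]
  refine mul_le_mul_of_nonneg_right ?_ h3.le
  nlinarith

/-- A nonnegative function that vanishes at `a` and has quadratic bounds. The lower bound involves
`|t| - a` instead of `t - a`, so that a second zero at `-a` is allowed. -/
structure QuadraticWell (f : ℝ → ℝ) (a c K : ℝ) : Prop where
  continuous : Continuous f
  a_nonneg : 0 ≤ a
  c_pos : 0 < c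
  K_pos : 0 < K
  lower : ∀ t, c * (|t| - a) ^ 2 ≤ f t
  upper : ∀ t, f t ≤ K * (t - a) ^ 2

namespace QuadraticWell

variable {f : ℝ → ℝ} {a c K : ℝ}

theorem nonneg (w : QuadraticWell f a c K) (t : ℝ) : 0 ≤ f t :=
  (mul_nonneg w.c_pos.le (sq_nonneg _)).trans (w.lower t)

/-- The exponent `s` is real because the mean of `f` itself is estimated through `s = n / 2`, see
`exists_gibbsMean_mul_exp_le`. -/
theorem exists_integral_exp_le (w : QuadraticWell f a c K) (A : ℝ) :
    ∃ C : ℝ, 0 < C ∧ ∀ s : ℝ, 1 / 2 ≤ s →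
      MeasureTheory.Integrable (fun t => Real.exp (A * |t|) * Real.exp (-(s * f t))) ∧
      ∫ t, Real.exp (A * |t|) * Real.exp (-(s * f t)) ≤ C / √s := by
  have hc := w.c_pos
  set M := Real.exp (A * a + A ^ 2 / c)
  refine ⟨M * (2 * √(2 * Real.pi / c)), by positivity, fun s hs => ?_⟩
  have hs0 : 0 < s := by linarith
  have hk : 0 < s * c / 2 := by positivity
  have hbd : ∀ t, Real.exp (A * |t|) * Real.exp (-(s * f t)) ≤
      M * (Real.exp (-(s * c / 2) * (t - a) ^ 2) + Real.exp (-(s * c / 2) * (t - -a) ^ 2)) := by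
    intro t
    have h1 : Real.exp (A * |t|) * Real.exp (-(s * f t))
        ≤ M * Real.exp (-(s * c / 2) * (|t| - a) ^ 2) := by
      rw [← Real.exp_add, ← Real.exp_add, Real.exp_le_exp]
      have h2 := mul_le_mul_of_nonneg_left (w.lower t) hs0.le
      set x := |t| - a
      have h3 : A * x ≤ A ^ 2 / c + s * c / 2 * x ^ 2 := by
        have h4 : A * x ≤ A ^ 2 / c + c / 4 * x ^ 2 := by
          have : 0 ≤ (A - c * x / 2) ^ 2 / c := by positivity
          have e : (A - c * x / 2) ^ 2 / c = A ^ 2 / c - A * x + c / 4 * x ^ 2 := by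
            field_simp; ring
          linarith
        have : c / 4 * x ^ 2 ≤ s * c / 2 * x ^ 2 :=
          mul_le_mul_of_nonneg_right (by nlinarith) (sq_nonneg _)
        linarith
      have e : A * |t| = A * a + A * x := by simp only [x]; ring
      rw [e]
      nlinarith
    exact h1.trans (mul_le_mul_of_nonneg_left (exp_neg_sq_abs_sub_le _ _ t) (Real.exp_pos _).le)
  have hI1 := integrable_gaussian_shift hk a
  have hI2 := integrable_gaussian_shift hk (-a)
  have hI := (hI1.add hI2).const_mul M
  have hcont := w.continuous
  have hint : MeasureTheory.Integrable
      (fun t => Real.exp (A * |t|) * Real.exp (-(s * f t))) := by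
    refine hI.mono' (by fun_prop) (Eventually.of_forall fun t => ?_)
    rw [Real.norm_eq_abs, abs_of_pos (by positivity)]
    exact hbd t
  refine ⟨hint, (MeasureTheory.integral_mono hint hI hbd).trans_eq ?_⟩
  simp only [Pi.add_apply]
  rw [MeasureTheory.integral_const_mul, MeasureTheory.integral_add hI1 hI2,
    integral_gaussian_shift, integral_gaussian_shift,
    show Real.pi / (s * c / 2) = (2 * Real.pi / c) / s by field_simp, Real.sqrt_div' _ hs0.le]
  ring

theorem integrable_exp (w : QuadraticWell f a c K) (A : ℝ) {n : ℕ} (hn : 1 ≤ n) :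
    MeasureTheory.Integrable (fun t => Real.exp (A * |t|) * Real.exp (-(n * f t))) := by
  obtain ⟨C, -, h⟩ := w.exists_integral_exp_le A
  have : (1 : ℝ) ≤ n := by exact_mod_cast hn
  exact (h n (by linarith)).1

/-- Functions of at most exponential growth are integrable against `exp (-n f)`. -/
theorem integrable_mul (w : QuadraticWell f a c K) {A C : ℝ} {n : ℕ} (hn : 1 ≤ n)
    {g : ℝ → ℝ} (hg : MeasureTheory.AEStronglyMeasurable g)
    (hgb : ∀ t, |g t| ≤ C * Real.exp (A * |t|)) :
    MeasureTheory.Integrable (fun t => g t * Real.exp (-(n * f t))) := by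
  have hcont := w.continuous
  refine ((w.integrable_exp A hn).const_mul C).mono'
    (hg.mul (by fun_prop : Continuous fun t => Real.exp (-(n * f t))).aestronglyMeasurable)
    (Eventually.of_forall fun t => ?_)
  rw [Real.norm_eq_abs, abs_mul, abs_of_pos (Real.exp_pos (-(n * f t))), ← mul_assoc]
  exact mul_le_mul_of_nonneg_right (hgb t) (Real.exp_pos _).le

theorem integrable_weight (w : QuadraticWell f a c K) {n : ℕ} (hn : 1 ≤ n) :
    MeasureTheory.Integrable (fun t => Real.exp (-(n * f t))) := by
  simpa using w.integrable_exp 0 hn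

theorem sqrt_le_integral (w : QuadraticWell f a c K) {n : ℕ} (hn : 1 ≤ n) :
    √(Real.pi / K) / √n ≤ ∫ t, Real.exp (-(n * f t)) := by
  have hK := w.K_pos
  have hn0 : (0 : ℝ) < n := by exact_mod_cast hn
  have h := MeasureTheory.integral_mono (integrable_gaussian_shift (mul_pos hn0 hK) a)
    (w.integrable_weight hn) (fun t => by
      rw [Real.exp_le_exp]
      have := mul_le_mul_of_nonneg_left (w.upper t) hn0.le
      linarith)
  rwa [integral_gaussian_shift, show Real.pi / (n * K) = Real.pi / K / n by field_simp,
    Real.sqrt_div' _ hn0.le] at h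

theorem integral_weight_pos (w : QuadraticWell f a c K) {n : ℕ} (hn : 1 ≤ n) :
    0 < ∫ t, Real.exp (-(n * f t)) := by
  have hK := w.K_pos
  have hn0 : (0 : ℝ) < n := by exact_mod_cast hn
  exact lt_of_lt_of_le (by positivity) (w.sqrt_le_integral hn)

/-- Exponential moments are bounded uniformly in `n`. -/
theorem exists_gibbsMean_exp_le (w : QuadraticWell f a c K) (A : ℝ) :
    ∃ C : ℝ, 0 < C ∧ ∀ n : ℕ, 1 ≤ n → ∫ t, Real.exp (A * |t|) * Real.exp (-(n * f t)) ≤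
      C * ∫ t, Real.exp (-(n * f t)) := by
  obtain ⟨C, hC, h⟩ := w.exists_integral_exp_le A
  have hK := w.K_pos
  have hp : 0 < √(Real.pi / K) := by positivity
  refine ⟨C / √(Real.pi / K), by positivity, fun n hn => ?_⟩
  have hn1 : (1 : ℝ) ≤ n := by exact_mod_cast hn
  calc _ ≤ C / √n := (h n (by linarith)).2
    _ = C / √(Real.pi / K) * (√(Real.pi / K) / √n) := by field_simp
    _ ≤ _ := mul_le_mul_of_nonneg_left (w.sqrt_le_integral hn) (by positivity)

/-- The mean of `f` is `O(1 / n)`, even with an exponential weight, since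
`f exp (-n f) ≤ (2 / n) exp (-n f / 2)`. -/
theorem exists_gibbsMean_mul_exp_le (w : QuadraticWell f a c K) (A : ℝ) :
    ∃ C : ℝ, 0 < C ∧ ∀ n : ℕ, 1 ≤ n →
      MeasureTheory.Integrable (fun t => f t * Real.exp (A * |t|) * Real.exp (-(n * f t))) ∧
      ∫ t, f t * Real.exp (A * |t|) * Real.exp (-(n * f t)) ≤
        C / n * ∫ t, Real.exp (-(n * f t)) := by
  obtain ⟨C, hC, h⟩ := w.exists_integral_exp_le A
  have hK := w.K_pos
  have hp : 0 < √(Real.pi / K) := by positivity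
  refine ⟨2 * √2 * C / √(Real.pi / K), by positivity, fun n hn => ?_⟩
  have hn1 : (1 : ℝ) ≤ n := by exact_mod_cast hn
  have hn0 : (0 : ℝ) < n := by linarith
  obtain ⟨hi, hb⟩ := h (n / 2) (by linarith)
  have hpt : ∀ t, f t * Real.exp (A * |t|) * Real.exp (-(n * f t)) ≤
      2 / n * (Real.exp (A * |t|) * Real.exp (-(n / 2 * f t))) := by
    intro t
    have h1 := mul_exp_neg_le (x := n * f t)
    rw [show n * f t / 2 = n / 2 * f t by ring] at h1
    have h2 := mul_le_mul_of_nonneg_left h1 (by positivity : 0 ≤ Real.exp (A * |t|) / n)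
    calc _ = Real.exp (A * |t|) / n * (n * f t * Real.exp (-(n * f t))) := by field_simp
      _ ≤ _ := h2
      _ = _ := by ring
  have hcont := w.continuous
  have hint : MeasureTheory.Integrable
      (fun t => f t * Real.exp (A * |t|) * Real.exp (-(n * f t))) := by
    refine (hi.const_mul (2 / n)).mono' (by fun_prop) (Eventually.of_forall fun t => ?_)
    rw [Real.norm_eq_abs, abs_of_nonneg
      (mul_nonneg (mul_nonneg (w.nonneg t) (Real.exp_pos _).le) (Real.exp_pos _).le)]
    exact hpt t
  refine ⟨hint, ?_⟩
  calc _ ≤ ∫ t, 2 / n * (Real.exp (A * |t|) * Real.exp (-(n / 2 * f t))) :=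
        MeasureTheory.integral_mono hint (hi.const_mul _) hpt
    _ ≤ 2 / n * (C / √(n / 2)) := by
        rw [MeasureTheory.integral_const_mul]
        exact mul_le_mul_of_nonneg_left hb (by positivity)
    _ = 2 * √2 * C / √(Real.pi / K) / n * (√(Real.pi / K) / √n) := by
        rw [Real.sqrt_div' _ (by norm_num)]
        field_simp
    _ ≤ _ := mul_le_mul_of_nonneg_left (w.sqrt_le_integral hn) (by positivity)

/-- Integration by parts: `ξ f'` has mean `O(1 / n)` under the density `exp (-n f)`. -/
theorem exists_abs_integral_mul_deriv_le (w : QuadraticWell f a c K) {A C : ℝ}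
    {f' ξ ξ' : ℝ → ℝ} (hf : ∀ t, HasDerivAt f (f' t) t) (hξ : ∀ t, HasDerivAt ξ (ξ' t) t)
    (hf'c : Continuous f') (hξ'c : Continuous ξ')
    (hξb : ∀ t, |ξ t| ≤ C * Real.exp (A * |t|)) (hξ'b : ∀ t, |ξ' t| ≤ C * Real.exp (A * |t|))
    (hξf : ∀ t, |ξ t * f' t| ≤ C * Real.exp (A * |t|)) :
    ∃ D : ℝ, ∀ n : ℕ, 1 ≤ n → |∫ t, ξ t * f' t * Real.exp (-(n * f t))| ≤
      D / n * ∫ t, Real.exp (-(n * f t)) := by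
  obtain ⟨D, hD, h⟩ := w.exists_gibbsMean_exp_le A
  refine ⟨C * D, fun n hn => ?_⟩
  have hn0 : (0 : ℝ) < n := by exact_mod_cast hn
  have hξc : Continuous ξ := continuous_iff_continuousAt.2 fun t => (hξ t).continuousAt
  have hC : 0 ≤ C := by
    have := (abs_nonneg _).trans (hξb 0)
    simpa using this
  have i1 := w.integrable_mul hn hξc.aestronglyMeasurable hξb
  have i2 := w.integrable_mul hn hξ'c.aestronglyMeasurable hξ'b
  have i3 : MeasureTheory.Integrable (fun t => ξ t * f' t * Real.exp (-(n * f t))) :=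
    w.integrable_mul hn (hξc.mul hf'c).aestronglyMeasurable hξf
  have hd : ∀ t, HasDerivAt (fun t => ξ t * Real.exp (-(n * f t)))
      (ξ' t * Real.exp (-(n * f t)) - n * (ξ t * f' t * Real.exp (-(n * f t)))) t := by
    intro t
    exact ((hξ t).fun_mul ((hf t).const_mul (n : ℝ)).fun_neg.exp).congr_deriv (by ring)
  have h0 := MeasureTheory.integral_eq_zero_of_hasDerivAt_of_integrable hd
    (i2.sub (i3.const_mul _)) i1
  rw [MeasureTheory.integral_sub i2 (i3.const_mul _), MeasureTheory.integral_const_mul,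
    sub_eq_zero] at h0
  have h1 : |∫ t, ξ' t * Real.exp (-(n * f t))| ≤ C * (D * ∫ t, Real.exp (-(n * f t))) := by
    calc _ ≤ ∫ t, |ξ' t * Real.exp (-(n * f t))| := MeasureTheory.abs_integral_le_integral_abs
      _ ≤ ∫ t, C * (Real.exp (A * |t|) * Real.exp (-(n * f t))) := by
          refine MeasureTheory.integral_mono i2.abs ((w.integrable_exp A hn).const_mul C) ?_
          intro t
          simp only
          rw [abs_mul, abs_of_pos (Real.exp_pos (-(n * f t))), ← mul_assoc]
          exact mul_le_mul_of_nonneg_right (hξ'b t) (Real.exp_pos _).le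
      _ ≤ _ := by
          rw [MeasureTheory.integral_const_mul]
          exact mul_le_mul_of_nonneg_left (h n hn) hC
  rw [h0, abs_mul, abs_of_pos hn0] at h1
  rw [div_mul_eq_mul_div, le_div_iff₀ hn0]
  linarith

/-- Laplace's method. The first-order term of `g` at the minimum is a multiple of `ξ f'`, whose mean
is `O(1 / n)` by an integration by parts, and the remainder is dominated by `f`, whose mean is
`O(1 / n)` as well. -/
theorem exists_abs_gibbsMean_sub_le (w : QuadraticWell f a c K) {A C : ℝ}
    {f' ξ ξ' g : ℝ → ℝ} {g₀ α : ℝ}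
    (hf : ∀ t, HasDerivAt f (f' t) t) (hξ : ∀ t, HasDerivAt ξ (ξ' t) t)
    (hf'c : Continuous f') (hξ'c : Continuous ξ') (hg : Continuous g)
    (hξb : ∀ t, |ξ t| ≤ C * Real.exp (A * |t|)) (hξ'b : ∀ t, |ξ' t| ≤ C * Real.exp (A * |t|))
    (hξf : ∀ t, |ξ t * f' t| ≤ C * Real.exp (A * |t|))
    (hgb : ∀ t, |g t| ≤ C * Real.exp (A * |t|))
    (hexp : ∀ t, |g t - g₀ - α * (ξ t * f' t)| ≤ C * (f t * Real.exp (A * |t|))) :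
    ∃ D : ℝ, ∀ n : ℕ, 1 ≤ n → |gibbsMean f n g - g₀| ≤ D / n := by
  obtain ⟨D₁, h₁⟩ := w.exists_abs_integral_mul_deriv_le hf hξ hf'c hξ'c hξb hξ'b hξf
  obtain ⟨D₂, hD₂, h₂⟩ := w.exists_gibbsMean_mul_exp_le A
  refine ⟨|α| * D₁ + C * D₂, fun n hn => ?_⟩
  have hn0 : (0 : ℝ) < n := by exact_mod_cast hn
  have hZ := w.integral_weight_pos hn
  have hξc : Continuous ξ := continuous_iff_continuousAt.2 fun t => (hξ t).continuousAt
  have hC : 0 ≤ C := by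
    have := (abs_nonneg _).trans (hξb 0)
    simpa using this
  have i1 := w.integrable_mul hn hg.aestronglyMeasurable hgb
  have i0 := (w.integrable_weight hn).const_mul g₀
  have i3 := (w.integrable_mul hn (hξc.mul hf'c).aestronglyMeasurable hξf).const_mul α
  have i4 := (i1.sub i0).sub i3
  set Z := ∫ t, Real.exp (-(n * f t))
  have e : gibbsMean f n g - g₀
      = ((∫ t, ((g t * Real.exp (-(n * f t)) - g₀ * Real.exp (-(n * f t)))
        - α * (ξ t * f' t * Real.exp (-(n * f t)))))
        + α * ∫ t, ξ t * f' t * Real.exp (-(n * f t))) / Z := by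
    have s1 := MeasureTheory.integral_sub (i1.sub i0) i3
    have s2 := MeasureTheory.integral_sub i1 i0
    simp only [Pi.mul_apply, Pi.sub_apply] at s1 s2
    rw [s1, s2, MeasureTheory.integral_const_mul, MeasureTheory.integral_const_mul,
      show gibbsMean f n g = (∫ t, g t * Real.exp (-(n * f t))) / Z from rfl]
    field_simp
    ring
  rw [e, abs_div, abs_of_pos hZ, div_le_iff₀ hZ]
  refine (abs_add_le _ _).trans ?_
  rw [abs_mul]
  have hrem : |∫ t, ((g t * Real.exp (-(n * f t)) - g₀ * Real.exp (-(n * f t)))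
        - α * (ξ t * f' t * Real.exp (-(n * f t))))| ≤ C * (D₂ / n * Z) := by
    refine MeasureTheory.abs_integral_le_integral_abs.trans ?_
    refine (MeasureTheory.integral_mono i4.abs ((h₂ n hn).1.const_mul C) fun t => ?_).trans ?_
    · simp only [Pi.sub_apply, Pi.mul_apply]
      rw [show g t * Real.exp (-(n * f t)) - g₀ * Real.exp (-(n * f t))
        - α * (ξ t * f' t * Real.exp (-(n * f t)))
        = (g t - g₀ - α * (ξ t * f' t)) * Real.exp (-(n * f t)) by ring, abs_mul,
        abs_of_pos (Real.exp_pos (-(n * f t))), ← mul_assoc C]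
      exact mul_le_mul_of_nonneg_right (hexp t) (Real.exp_pos _).le
    · rw [MeasureTheory.integral_const_mul]
      exact mul_le_mul_of_nonneg_left (h₂ n hn).2 hC
  have := mul_le_mul_of_nonneg_left (h₁ n hn) (abs_nonneg α)
  calc _ ≤ C * (D₂ / n * Z) + |α| * (D₁ / n * Z) := add_le_add hrem this
    _ = _ := by ring

end QuadraticWell

/-! ### A local limit theorem for independent spins -/

/-- The Fourier integrand for the event that the signed sum equals `1`, when `2 m + 1` independent
spins are biased by an external field `t`. -/
noncomputable def spinKernel (m : ℕ) (t φ : ℝ) : ℝ :=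
  (1 - Real.sin φ ^ 2 / Real.cosh t ^ 2) ^ m *
    (1 - Real.exp t * Real.sin φ ^ 2 / Real.cosh t)

/-- The probability that the signed sum of `2 m + 1` independent spins in the external field `t`
equals `1`, as a Fourier integral. -/
noncomputable def spinProb (m : ℕ) (t : ℝ) : ℝ :=
  1 / Real.pi * ∫ φ in (-(Real.pi / 2))..(Real.pi / 2), spinKernel m t φ

theorem continuous_spinKernel (m : ℕ) : Continuous fun p : ℝ × ℝ => spinKernel m p.1 p.2 := by
  have h1 := Real.continuous_cosh
  have h : ∀ t, Real.cosh t ≠ 0 := fun t => (Real.cosh_pos t).ne'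
  unfold spinKernel
  refine ((continuous_const.sub ((Real.continuous_sin.comp continuous_snd).pow 2 |>.div
    ((h1.comp continuous_fst).pow 2) fun p => pow_ne_zero 2 (h _))).pow m).mul
    (continuous_const.sub (Continuous.div (by fun_prop) (h1.comp continuous_fst) fun p => h _))

theorem continuous_spinKernel_right (m : ℕ) (t : ℝ) : Continuous (spinKernel m t) := by
  unfold spinKernel
  fun_prop

theorem continuous_spinProb (m : ℕ) : Continuous (spinProb m) := by
  unfold spinProb
  exact continuous_const.mul
    (intervalIntegral.continuous_parametric_intervalIntegral_of_continuous'
      (continuous_spinKernel m) _ _)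

theorem sq_sub_sin_sq_le (x : ℝ) : x ^ 2 - Real.sin x ^ 2 ≤ x ^ 4 / 3 := by
  wlog hx : 0 ≤ x generalizing x
  · have := this (-x) (by linarith)
    simpa [Even.neg_pow (by decide : Even 4)] using this
  have h1 : Real.sin x ≤ x := Real.sin_le hx
  have h2 : x - x ^ 3 / 6 ≤ Real.sin x := by
    rcases hx.eq_or_lt with h | h
    · simp [← h]
    · exact (Real.sin_gt_sub_cube h).le
  have h3 : -x ≤ Real.sin x := by
    have := (abs_le.1 (Real.abs_sin_le_abs (x := x))).1
    rwa [abs_of_nonneg hx] at this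
  have : (x - Real.sin x) * (x + Real.sin x) ≤ x ^ 3 / 6 * (x + x) :=
    mul_le_mul (by linarith) (by linarith) (by linarith) (by positivity)
  nlinarith

theorem two_fifths_sq_le_sin_sq {x : ℝ} (hx : |x| ≤ Real.pi / 2) :
    2 / 5 * x ^ 2 ≤ Real.sin x ^ 2 := by
  have h1 := Real.mul_le_sin (abs_nonneg x) hx
  have h2 : (2 / Real.pi * |x|) ^ 2 ≤ Real.sin |x| ^ 2 := by
    have := Real.pi_pos
    gcongr
  have h3 : Real.sin |x| ^ 2 = Real.sin x ^ 2 := by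
    rcases abs_choice x with h | h <;> simp [h]
  rw [h3, mul_pow, sq_abs, div_pow] at h2
  refine le_trans (mul_le_mul_of_nonneg_right ?_ (sq_nonneg x)) h2
  rw [div_le_div_iff₀ (by norm_num) (by positivity)]
  nlinarith [Real.pi_lt_d2, Real.pi_pos]

theorem abs_exp_neg_sub_le {u : ℝ} (hu : 0 ≤ u) : |Real.exp (-u) - (1 - u)| ≤ u ^ 2 / 2 := by
  have h1 := Real.one_sub_le_exp_neg u
  rw [abs_of_nonneg (by linarith)]
  have h := le_of_hasDerivAt_nonneg (f := fun u => u ^ 2 / 2 - (Real.exp (-u) - (1 - u))) hu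
    (fun z _ => ((hasDerivAt_pow 2 z).div_const 2).sub
      ((hasDerivAt_neg z).exp.sub ((hasDerivAt_id z).const_sub 1)))
    (fun z _ => by
      have := Real.one_sub_le_exp_neg z
      norm_num
      linarith)
  simp at h
  linarith

theorem exp_le_two_mul_cosh (t : ℝ) : Real.exp t ≤ 2 * Real.cosh t := by
  rw [Real.cosh_eq]
  linarith [Real.exp_pos (-t)]

/-- Gaussian approximation of the Fourier integrand. The exponent of the Gaussian is taken with
`2 m + 1` rather than `2 m`, which absorbs a correction of relative order `1 / m`. -/
theorem abs_spinKernel_sub_le {m : ℕ} (hm : 1 ≤ m) (t : ℝ) {x : ℝ} (hx : |x| ≤ Real.pi / 2) :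
    |spinKernel m t x - Real.exp (-((2 * m + 1) / (2 * Real.cosh t ^ 2)) * x ^ 2)| ≤
      17 * (x ^ 2 * Real.exp (-((2 * m + 1) / (15 * Real.cosh t ^ 2)) * x ^ 2)) := by
  have hc1 := Real.one_le_cosh t
  have hm1 : (1 : ℝ) ≤ m := by exact_mod_cast hm
  set c := Real.cosh t with hc
  have hc0 : 0 < c := by linarith
  have hc2 : 1 ≤ c ^ 2 := by nlinarith
  set s := Real.sin x ^ 2 with hs
  have hs0 : 0 ≤ s := sq_nonneg _
  have hs1 : s ≤ 1 := Real.sin_sq_le_one x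
  have hsx : s ≤ x ^ 2 := by
    rw [hs, sq_le_sq]; exact Real.abs_sin_le_abs
  have hsl : 2 / 5 * x ^ 2 ≤ s := two_fifths_sq_le_sin_sq hx
  have hsu := sq_sub_sin_sq_le x
  rw [← hs] at hsu
  set u := x ^ 2 / c ^ 2 with hu
  have hu0 : 0 ≤ u := by positivity
  have hux : u ≤ x ^ 2 := div_le_self (sq_nonneg _) hc2
  set X := 1 - s / c ^ 2 with hX
  set Y := Real.exp (-u) with hY
  set G := Real.exp (-(2 / 5 * u)) with hG
  have hX0 : 0 ≤ X := by
    rw [hX, sub_nonneg, div_le_one (by positivity)]; linarith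
  have hXG : X ≤ G := by
    refine (Real.one_sub_le_exp_neg _).trans (Real.exp_le_exp.2 ?_)
    rw [hu, neg_le_neg_iff, ← mul_div_assoc]
    exact div_le_div_of_nonneg_right hsl (by positivity)
  have hYG : Y ≤ G := Real.exp_le_exp.2 (by linarith)
  have hG0 : 0 < G := Real.exp_pos _
  have hY0 : 0 < Y := Real.exp_pos _
  have hXY : |X - Y| ≤ x ^ 2 * u := by
    have h1 := abs_exp_neg_sub_le hu0
    have h2 : |(1 - u) - X| ≤ x ^ 2 * u / 3 := by
      have e : (1 - u) - X = -((x ^ 2 - s) / c ^ 2) := by rw [hX, hu]; ring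
      rw [e, abs_neg, abs_of_nonneg (div_nonneg (by linarith) (by positivity)),
        div_le_iff₀ (by positivity)]
      have e2 : x ^ 2 * u / 3 * c ^ 2 = x ^ 4 / 3 := by rw [hu]; field_simp
      rw [e2]; exact hsu
    have h3 : |X - Y| ≤ |Y - (1 - u)| + |(1 - u) - X| := by
      rw [abs_sub_comm X Y]
      exact abs_sub_le _ _ _
    have h4 : u ^ 2 ≤ x ^ 2 * u := by nlinarith
    have : 0 ≤ x ^ 2 * u := by positivity
    linarith
  -- `v` is half of the exponent in `G ^ m`
  set v := m * u / 5 with hv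
  have hGm : G ^ m = Real.exp (-(2 * v)) := by
    rw [hG, ← Real.exp_nat_mul, hv]; congr 1; ring
  have hv0 : 0 ≤ v := by positivity
  have hGE : G ^ m ≤ Real.exp (-v) := by rw [hGm]; exact Real.exp_le_exp.2 (by linarith)
  have hG1 : G ^ (m - 1) ≤ 2.72 * G ^ m := by
    have e : G ^ m = G ^ (m - 1) * G := by
      rw [← pow_succ, Nat.sub_add_cancel hm]
    have h1 : 1 ≤ 2.72 * G := by
      have h2 : 2 / 5 * u ≤ 1 := by linarith
      have h3 : Real.exp (-1) ≤ G := Real.exp_le_exp.2 (by linarith)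
      have h4 := Real.exp_one_lt_d9
      have h5 : Real.exp (-1) * Real.exp 1 = 1 := by rw [← Real.exp_add]; simp
      nlinarith [Real.exp_pos (-1)]
    have : 0 < G ^ (m - 1) := by positivity
    rw [e]
    nlinarith
  -- one factor `u` is traded for `1 / m` by means of `2 v exp (-2 v) ≤ 2 exp (-v)`
  have hpow : |X ^ m - Y ^ m| ≤ 13.6 * (x ^ 2 * Real.exp (-v)) := by
    have h1 := abs_pow_sub_pow_le X Y m
    have h2 : max |X| |Y| ^ (m - 1) ≤ G ^ (m - 1) := by
      rw [abs_of_nonneg hX0, abs_of_pos hY0]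
      exact pow_le_pow_left₀ (le_max_of_le_left hX0) (max_le hXG hYG) _
    have h3 : |X - Y| * m * max |X| |Y| ^ (m - 1) ≤ (x ^ 2 * u) * m * (2.72 * G ^ m) := by
      have : 0 ≤ max |X| |Y| := le_max_of_le_left (abs_nonneg X)
      exact mul_le_mul (mul_le_mul_of_nonneg_right hXY (by positivity)) (h2.trans hG1)
        (by positivity) (by positivity)
    have h4 := mul_exp_neg_le (x := 2 * v)
    rw [← hGm, show 2 * v / 2 = v by ring] at h4
    have h5 := mul_le_mul_of_nonneg_left h4 (by positivity : 0 ≤ 6.8 * x ^ 2)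
    have e : (x ^ 2 * u) * m * (2.72 * G ^ m) = 6.8 * x ^ 2 * (2 * v * G ^ m) := by
      rw [hv]; ring
    rw [e] at h3
    linarith
  have hYm : Y ^ m = Real.exp (-(m * u)) := by
    rw [hY, ← Real.exp_nat_mul]; congr 1; ring
  have hlast : |Y ^ m - Real.exp (-((2 * m + 1) / (2 * c ^ 2)) * x ^ 2)|
      ≤ 1 / 2 * (x ^ 2 * Real.exp (-v)) := by
    have e : Real.exp (-((2 * m + 1) / (2 * c ^ 2)) * x ^ 2) = Y ^ m * Real.exp (-(u / 2)) := by
      rw [hYm, ← Real.exp_add, hu]; congr 1; field_simp; ring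
    have h1 := Real.one_sub_le_exp_neg (u / 2)
    have h2 : Real.exp (-(u / 2)) ≤ 1 := Real.exp_le_one_iff.2 (by linarith)
    have h3 : Y ^ m ≤ Real.exp (-v) := (pow_le_pow_left₀ hY0.le hYG m).trans hGE
    have h4 : 0 < Y ^ m := by positivity
    rw [e, show Y ^ m - Y ^ m * Real.exp (-(u / 2)) = Y ^ m * (1 - Real.exp (-(u / 2))) by ring,
      abs_mul, abs_of_pos h4, abs_of_nonneg (by linarith)]
    calc _ ≤ Real.exp (-v) * (x ^ 2 / 2) :=
          mul_le_mul h3 (by linarith) (by linarith) (Real.exp_pos _).le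
      _ = _ := by ring
  have hmid : |X ^ m * (1 - Real.exp t * s / c) - X ^ m| ≤ 2 * (x ^ 2 * Real.exp (-v)) := by
    rw [show X ^ m * (1 - Real.exp t * s / c) - X ^ m = -(X ^ m * (Real.exp t * s / c)) by ring,
      abs_neg, abs_of_nonneg (by positivity)]
    have h1 : X ^ m ≤ Real.exp (-v) := (pow_le_pow_left₀ hX0 hXG m).trans hGE
    have h2 : Real.exp t * s / c ≤ 2 * x ^ 2 := by
      rw [div_le_iff₀ hc0]
      have := mul_le_mul (exp_le_two_mul_cosh t) hsx hs0 (by positivity)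
      rw [← hc] at this
      linarith
    calc _ ≤ Real.exp (-v) * (2 * x ^ 2) :=
          mul_le_mul h1 h2 (by positivity) (Real.exp_pos _).le
      _ = _ := by ring
  have htot : |spinKernel m t x - Real.exp (-((2 * m + 1) / (2 * c ^ 2)) * x ^ 2)| ≤
      17 * (x ^ 2 * Real.exp (-v)) := by
    have e : spinKernel m t x - Real.exp (-((2 * m + 1) / (2 * c ^ 2)) * x ^ 2)
      = (X ^ m * (1 - Real.exp t * s / c) - X ^ m) + (X ^ m - Y ^ m)
        + (Y ^ m - Real.exp (-((2 * m + 1) / (2 * c ^ 2)) * x ^ 2)) := by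
      rw [spinKernel, ← hs, ← hc, ← hX]; ring
    rw [e]
    have h1 := abs_add_le ((X ^ m * (1 - Real.exp t * s / c) - X ^ m) + (X ^ m - Y ^ m))
      (Y ^ m - Real.exp (-((2 * m + 1) / (2 * c ^ 2)) * x ^ 2))
    have h2 := abs_add_le (X ^ m * (1 - Real.exp t * s / c) - X ^ m) (X ^ m - Y ^ m)
    have : 0 ≤ x ^ 2 * Real.exp (-v) := by positivity
    linarith
  refine htot.trans ?_
  gcongr
  rw [hv, hu, show -((2 * m + 1) / (15 * c ^ 2)) * x ^ 2
    = -((2 * m + 1) / 15 * (x ^ 2 / c ^ 2)) by field_simp, neg_le_neg_iff, mul_div_right_comm]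
  exact mul_le_mul_of_nonneg_right (by linarith) hu0

theorem integrable_sq_mul_gaussian {k : ℝ} (hk : 0 < k) :
    MeasureTheory.Integrable fun x : ℝ => x ^ 2 * Real.exp (-k * x ^ 2) := by
  simpa using integrable_rpow_mul_exp_neg_mul_sq hk (s := 2) (by norm_num)

theorem integral_sq_mul_gaussian_le {k : ℝ} (hk : 0 < k) :
    ∫ x : ℝ, x ^ 2 * Real.exp (-k * x ^ 2) ≤ 2 / k * √(2 * Real.pi / k) := by
  have hpt : ∀ x : ℝ, x ^ 2 * Real.exp (-k * x ^ 2) ≤ 2 / k * Real.exp (-(k / 2) * x ^ 2) := by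
    intro x
    have h1 := mul_exp_neg_le (x := k * x ^ 2)
    rw [show -(k * x ^ 2) = -k * x ^ 2 by ring,
      show -(k * x ^ 2 / 2) = -(k / 2) * x ^ 2 by ring] at h1
    rw [div_mul_eq_mul_div, le_div_iff₀ hk]
    linarith
  have h := MeasureTheory.integral_mono (integrable_sq_mul_gaussian hk)
    ((integrable_exp_neg_mul_sq (half_pos hk)).const_mul (2 / k)) hpt
  rwa [MeasureTheory.integral_const_mul, integral_gaussian,
    show Real.pi / (k / 2) = 2 * Real.pi / k by field_simp] at h

theorem abs_indicator_spinKernel_sub_le {m : ℕ} (hm : 1 ≤ m) (t x : ℝ) :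
    |(Set.Ioc (-(Real.pi / 2)) (Real.pi / 2)).indicator (spinKernel m t) x
        - Real.exp (-((2 * m + 1) / (2 * Real.cosh t ^ 2)) * x ^ 2)| ≤
      17 * (x ^ 2 * Real.exp (-((2 * m + 1) / (15 * Real.cosh t ^ 2)) * x ^ 2)) := by
  by_cases hx : x ∈ Set.Ioc (-(Real.pi / 2)) (Real.pi / 2)
  · rw [Set.indicator_of_mem hx]
    exact abs_spinKernel_sub_le hm t (abs_le.2 ⟨hx.1.le, hx.2⟩)
  · rw [Set.indicator_of_notMem hx, zero_sub, abs_neg, abs_of_pos (Real.exp_pos _)]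
    have hx1 : 1 ≤ x ^ 2 := by
      have h3 := Real.pi_gt_three
      rw [one_le_sq_iff_one_le_abs]
      by_contra h
      rw [not_le, abs_lt] at h
      exact hx ⟨by linarith, by linarith⟩
    have hc := Real.cosh_pos t
    have h1 : Real.exp (-((2 * m + 1) / (2 * Real.cosh t ^ 2)) * x ^ 2)
        ≤ Real.exp (-((2 * m + 1) / (15 * Real.cosh t ^ 2)) * x ^ 2) := by
      rw [Real.exp_le_exp]
      refine mul_le_mul_of_nonneg_right ?_ (sq_nonneg x)
      rw [neg_le_neg_iff]
      exact div_le_div_of_nonneg_left (by positivity) (by positivity)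
        (mul_le_mul_of_nonneg_right (by norm_num) (by positivity))
    have h2 := Real.exp_pos (-((2 * m + 1) / (15 * Real.cosh t ^ 2)) * x ^ 2)
    have h3 := mul_le_mul_of_nonneg_right hx1 h2.le
    linarith

/-- Local limit theorem, uniform in the external field up to an exponential factor in the error. -/
theorem exists_abs_spinProb_sub_le : ∃ C : ℝ, 0 < C ∧ ∀ m : ℕ, 1 ≤ m → ∀ t : ℝ,
    |spinProb m t - √(2 / Real.pi) * Real.cosh t / √(2 * m + 1)| ≤
      C * Real.exp (3 * |t|) / ((2 * m + 1) * √(2 * m + 1)) := by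
  refine ⟨1 / Real.pi * (17 * (30 * √(30 * Real.pi))), by positivity, fun m hm t => ?_⟩
  have hc1 := Real.one_le_cosh t
  have hm1 : (1 : ℝ) ≤ m := by exact_mod_cast hm
  set c := Real.cosh t with hc
  set N : ℝ := 2 * m + 1 with hN
  have hN0 : 0 < N := by positivity
  have hc0 : 0 < c := by linarith
  set S := Set.Ioc (-(Real.pi / 2)) (Real.pi / 2) with hS
  have hk : 0 < N / (15 * c ^ 2) := by positivity
  have hk2 : 0 < N / (2 * c ^ 2) := by positivity
  have hcontK := continuous_spinKernel_right m t
  have hint : MeasureTheory.Integrable (S.indicator (spinKernel m t)) := by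
    rw [MeasureTheory.integrable_indicator_iff measurableSet_Ioc]
    exact hcontK.integrableOn_Ioc
  have hpt := abs_indicator_spinKernel_sub_le hm t
  rw [← hS, ← hc, ← hN] at hpt
  have hG := integrable_exp_neg_mul_sq hk2
  have hq : spinProb m t = 1 / Real.pi * ∫ x, S.indicator (spinKernel m t) x := by
    rw [spinProb, intervalIntegral.integral_of_le (by linarith [Real.pi_pos]),
      MeasureTheory.integral_indicator measurableSet_Ioc]
  have hmain : 1 / Real.pi * ∫ x, Real.exp (-(N / (2 * c ^ 2)) * x ^ 2)
      = √(2 / Real.pi) * c / √N := by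
    have hp := Real.pi_pos
    rw [integral_gaussian,
      show Real.pi / (N / (2 * c ^ 2)) = (2 / Real.pi) * (Real.pi * c) ^ 2 / N by field_simp,
      Real.sqrt_div' _ hN0.le, Real.sqrt_mul' _ (sq_nonneg _),
      Real.sqrt_sq (by positivity)]
    field_simp
  rw [hq, ← hmain, ← mul_sub, ← MeasureTheory.integral_sub hint hG, abs_mul,
    abs_of_pos (by positivity : 0 < 1 / Real.pi), mul_assoc, mul_div_assoc]
  refine mul_le_mul_of_nonneg_left ?_ (by positivity)
  calc _ ≤ ∫ x, |S.indicator (spinKernel m t) x - Real.exp (-(N / (2 * c ^ 2)) * x ^ 2)| :=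
        MeasureTheory.abs_integral_le_integral_abs
    _ ≤ ∫ x, 17 * (x ^ 2 * Real.exp (-(N / (15 * c ^ 2)) * x ^ 2)) :=
        MeasureTheory.integral_mono (hint.sub hG).abs
          ((integrable_sq_mul_gaussian hk).const_mul 17) hpt
    _ ≤ 17 * (2 / (N / (15 * c ^ 2)) * √(2 * Real.pi / (N / (15 * c ^ 2)))) := by
        rw [MeasureTheory.integral_const_mul]
        exact mul_le_mul_of_nonneg_left (integral_sq_mul_gaussian_le hk) (by norm_num)
    _ = 17 * (30 * √(30 * Real.pi)) * (c ^ 3 / (N * √N)) := by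
        rw [show 2 * Real.pi / (N / (15 * c ^ 2)) = (30 * Real.pi) * c ^ 2 / N by
          field_simp; ring, Real.sqrt_div' _ hN0.le, Real.sqrt_mul' _ (sq_nonneg _),
          Real.sqrt_sq hc0.le]
        field_simp
        ring
    _ ≤ 17 * (30 * √(30 * Real.pi)) * (Real.exp (3 * |t|) / (N * √N)) := by
        gcongr
        calc c ^ 3 ≤ Real.exp |t| ^ 3 := pow_le_pow_left₀ hc0.le (cosh_le_exp_abs t) 3
          _ = Real.exp (3 * |t|) := by rw [← Real.exp_nat_mul]; norm_num
    _ = _ := by ring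

/-! ### The signed sum as a mixture over external fields -/

theorem spin_eq (n : ℕ) (σ : Config n) (i : Fin n) : spin σ i = 1 ∨ spin σ i = -1 := by
  rcases Int.units_eq_one_or (σ i) with h | h <;> simp [spin, h]

/-- The sign of the site with index `j` in the signed sum of `2 m + 1` spins. -/
noncomputable def siteSign (m j : ℕ) : ℝ := if j < m then 1 else -1

theorem signedSum_eq (m : ℕ) (σ : Config (2 * m + 1)) :
    signedSum σ = ∑ j : Fin (2 * m + 1), siteSign m j * spin σ j := by
  have h1 : (2 * m + 1 - 1) / 2 = m := by omega
  have h2 : (2 * m + 1 + 1) / 2 = m + 1 := by omega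
  simp only [signedSum, siteSign, h1, h2]
  rw [Finset.sum_filter, Finset.sum_filter, ← Finset.sum_sub_distrib]
  refine Finset.sum_congr rfl fun j _ => ?_
  by_cases hj : (j : ℕ) < m
  · rw [if_pos (by omega), if_neg (by omega), if_pos hj]; ring
  · rw [if_neg (by omega), if_pos (by omega), if_neg hj]; ring

/-- An odd number of spins has an odd signed sum. -/
theorem exists_signedSum_sub_one (m : ℕ) (σ : Config (2 * m + 1)) :
    ∃ l : ℤ, signedSum σ - 1 = 2 * l := by
  have h : ∀ j : Fin (2 * m + 1), ∃ k : ℤ, siteSign m j * spin σ j = 1 + 2 * k := by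
    intro j
    rcases spin_eq _ σ j with h | h <;> rw [h] <;> unfold siteSign <;> split_ifs
    · exact ⟨0, by norm_num⟩
    · exact ⟨-1, by norm_num⟩
    · exact ⟨-1, by norm_num⟩
    · exact ⟨0, by norm_num⟩
  choose k hk using h
  refine ⟨m + ∑ j, k j, ?_⟩
  rw [signedSum_eq, Finset.sum_congr rfl fun j _ => hk j, Finset.sum_add_distrib,
    ← Finset.mul_sum]
  push_cast
  simp
  ring

theorem integral_cos_even_mul (l : ℤ) :
    ∫ φ in (-(Real.pi / 2))..(Real.pi / 2), Real.cos (φ * (2 * l)) =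
      if l = 0 then Real.pi else 0 := by
  split_ifs with h
  · simp [h]
  · have h2 : (2 * l : ℝ) ≠ 0 := by
      have : (l : ℝ) ≠ 0 := by exact_mod_cast h
      positivity
    rw [intervalIntegral.integral_comp_mul_right (fun x => Real.cos x) h2, integral_cos,
      show Real.pi / 2 * (2 * l) = l * Real.pi by ring,
      show -(Real.pi / 2) * (2 * l) = -(l * Real.pi) by ring, Real.sin_neg, Real.sin_int_mul_pi]
    simp

/-- The event `signedSum σ = 1` as a Fourier integral; as `signedSum σ - 1` is even, the period is
`π` only. -/
theorem integral_cos_signedSum (m : ℕ) (σ : Config (2 * m + 1)) :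
    1 / Real.pi * ∫ φ in (-(Real.pi / 2))..(Real.pi / 2), Real.cos (φ * (signedSum σ - 1)) =
      if signedSum σ = 1 then 1 else 0 := by
  obtain ⟨l, hl⟩ := exists_signedSum_sub_one m σ
  rw [hl, integral_cos_even_mul]
  have : signedSum σ = 1 ↔ l = 0 := by
    rw [← sub_eq_zero, hl]
    simp
  simp only [this]
  split_ifs
  · have := Real.pi_ne_zero
    field_simp
  · simp

theorem sum_config_prod {R : Type*} [CommRing R] {n : ℕ} (g : Fin n → ℤˣ → R) :
    ∑ σ : Config n, ∏ j, g j (σ j) = ∏ j, (g j 1 + g j (-1)) := by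
  rw [← Fintype.prod_sum]
  refine Finset.prod_congr rfl fun j _ => ?_
  rw [UnitsInt.univ, Finset.sum_pair (by decide)]

theorem sum_exp_mul_spin (n : ℕ) (t : ℝ) :
    ∑ σ : Config n, Real.exp (t * ∑ j, spin σ j) = (2 * Real.cosh t) ^ n := by
  have h := sum_config_prod (n := n) (fun _ u => Real.exp (t * ((u : ℤ) : ℝ)))
  simp only [← Real.exp_sum, ← Finset.mul_sum] at h
  simp only [spin]
  rw [h, Finset.prod_const, Finset.card_univ, Fintype.card_fin]
  congr 1
  rw [Real.cosh_eq]
  norm_num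
  ring

theorem sum_cexp_spin (m : ℕ) (t φ : ℝ) :
    ∑ σ : Config (2 * m + 1),
        Complex.exp (t * (∑ j, spin σ j : ℝ) + φ * Complex.I * (signedSum σ : ℝ))
      = (2 * Complex.cosh (t + φ * Complex.I)) ^ m
        * (2 * Complex.cosh (t - φ * Complex.I)) ^ (m + 1) := by
  have h := sum_config_prod (n := 2 * m + 1)
    (fun j u => Complex.exp ((t + φ * Complex.I * siteSign m j) * ((u : ℤ) : ℂ)))
  simp only [← Complex.exp_sum] at h
  have e : ∀ σ : Config (2 * m + 1),
      (t * (∑ j, spin σ j : ℝ) + φ * Complex.I * (signedSum σ : ℝ) : ℂ)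
      = ∑ j : Fin (2 * m + 1), (t + φ * Complex.I * siteSign m j) * ((σ j : ℤ) : ℂ) := by
    intro σ
    rw [signedSum_eq]
    push_cast
    rw [Finset.mul_sum, Finset.mul_sum, ← Finset.sum_add_distrib]
    refine Finset.sum_congr rfl fun j _ => ?_
    simp only [spin]
    push_cast
    ring
  simp only [e]
  rw [h]
  have e2 : ∀ z : ℂ,
      Complex.exp (z * (((1 : ℤˣ) : ℤ) : ℂ)) + Complex.exp (z * (((-1 : ℤˣ) : ℤ) : ℂ))
      = 2 * Complex.cosh z := by
    intro z
    rw [Complex.cosh]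
    norm_num
    ring
  simp only [e2]
  rw [Fin.prod_univ_eq_prod_range (fun j => 2 * Complex.cosh (t + φ * Complex.I * siteSign m j)),
    show 2 * m + 1 = m + (m + 1) by ring, Finset.prod_range_add]
  congr 1
  · rw [Finset.prod_congr rfl (g := fun _ => 2 * Complex.cosh (t + φ * Complex.I)),
      Finset.prod_const, Finset.card_range]
    intro j hj
    simp [siteSign, Finset.mem_range.1 hj]
  · rw [Finset.prod_congr rfl (g := fun _ => 2 * Complex.cosh (t - φ * Complex.I)),
      Finset.prod_const, Finset.card_range]
    intro j _
    simp [siteSign, sub_eq_add_neg]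

/-- Summing over all configurations factorizes; `cosh (t + iφ) cosh (t - iφ) = cosh² t - sin² φ`
pairs all sites but one, and the remaining site gives the second factor of `spinKernel`. -/
theorem sum_exp_mul_cos (m : ℕ) (t φ : ℝ) :
    ∑ σ : Config (2 * m + 1), Real.exp (t * ∑ j, spin σ j) * Real.cos (φ * (signedSum σ - 1))
      = (2 * Real.cosh t) ^ (2 * m + 1) * spinKernel m t φ := by
  have h := sum_cexp_spin m t φ
  have hc := (Real.cosh_pos t).ne'
  have e : ∀ σ : Config (2 * m + 1),
      Real.exp (t * ∑ j, spin σ j) * Real.cos (φ * (signedSum σ - 1))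
      = (Complex.exp (t * (∑ j, spin σ j : ℝ) + φ * Complex.I * (signedSum σ : ℝ))
        * Complex.exp (-φ * Complex.I)).re := by
    intro σ
    rw [← Complex.exp_add]
    rw [show (t * (∑ j, spin σ j : ℝ) + φ * Complex.I * (signedSum σ : ℝ) + -φ * Complex.I : ℂ)
      = ((t * ∑ j, spin σ j : ℝ) : ℂ) + ((φ * (signedSum σ - 1) : ℝ) : ℂ) * Complex.I by
        push_cast; ring, Complex.exp_re]
    simp
  simp only [e]
  rw [← Complex.re_sum, ← Finset.sum_mul, h]
  have h1 : (2 * Complex.cosh (t + φ * Complex.I)) ^ m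
        * (2 * Complex.cosh (t - φ * Complex.I)) ^ (m + 1) * Complex.exp (-φ * Complex.I)
      = (((4 * (Real.cosh t ^ 2 - Real.sin φ ^ 2)) ^ m : ℝ) : ℂ)
        * (2 * Complex.cosh (t - φ * Complex.I) * Complex.exp (-φ * Complex.I)) := by
    rw [pow_succ, ← mul_assoc, ← mul_pow, mul_assoc _ (2 * _)]
    congr 1
    push_cast
    congr 1
    rw [sub_eq_add_neg, ← neg_mul, Complex.cosh_add, Complex.cosh_add, Complex.cosh_mul_I,
      Complex.sinh_mul_I, Complex.cosh_mul_I, Complex.sinh_mul_I, Complex.cos_neg, Complex.sin_neg]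
    have h2 := Complex.cosh_sq (t : ℂ)
    have h3 := Complex.sin_sq_add_cos_sq (φ : ℂ)
    have h4 := Complex.I_sq
    linear_combination (-4 * Complex.sinh t ^ 2 * Complex.sin φ ^ 2) * h4
      + 4 * Complex.cosh t ^ 2 * h3 - 4 * Complex.sin φ ^ 2 * h2
  rw [h1, Complex.re_ofReal_mul]
  have h5 : (2 * Complex.cosh (t - φ * Complex.I) * Complex.exp (-φ * Complex.I)).re
      = 2 * Real.cosh t * (1 - Real.exp t * Real.sin φ ^ 2 / Real.cosh t) := by
    have h7 : 2 * Complex.cosh (t - φ * Complex.I) * Complex.exp (-φ * Complex.I)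
        = ((2 * (Real.cosh t * Real.cos φ ^ 2 - Real.sinh t * Real.sin φ ^ 2) : ℝ) : ℂ)
          + ((-2 * (Real.cosh t + Real.sinh t) * Real.cos φ * Real.sin φ : ℝ) : ℂ)
            * Complex.I := by
      rw [sub_eq_add_neg, ← neg_mul, Complex.cosh_add, Complex.cosh_mul_I, Complex.sinh_mul_I,
        ← Complex.cos_add_sin_I, Complex.cos_neg, Complex.sin_neg]
      push_cast
      linear_combination (2 * Complex.sinh t * Complex.sin φ ^ 2) * Complex.I_sq
    rw [h7, Complex.add_re, Complex.ofReal_re, Complex.re_ofReal_mul, Complex.I_re]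
    field_simp
    have h3 := Real.sin_sq_add_cos_sq φ
    rw [← Real.cosh_add_sinh t]
    linear_combination (Real.cosh t) * h3
  rw [h5, spinKernel]
  have h6 : 4 * (Real.cosh t ^ 2 - Real.sin φ ^ 2)
      = (2 * Real.cosh t) ^ 2 * (1 - Real.sin φ ^ 2 / Real.cosh t ^ 2) := by
    field_simp
    norm_num
    ring
  rw [h6, mul_pow, ← pow_mul, pow_succ]
  ring

open Classical in
theorem sum_exp_signedSum (m : ℕ) (t : ℝ) :
    ∑ σ : Config (2 * m + 1) with signedSum σ = 1, Real.exp (t * ∑ j, spin σ j)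
      = (2 * Real.cosh t) ^ (2 * m + 1) * spinProb m t := by
  have h : ∀ σ : Config (2 * m + 1),
      (if signedSum σ = 1 then Real.exp (t * ∑ j, spin σ j) else 0)
      = 1 / Real.pi * ∫ φ in (-(Real.pi / 2))..(Real.pi / 2),
        Real.exp (t * ∑ j, spin σ j) * Real.cos (φ * (signedSum σ - 1)) := by
    intro σ
    rw [intervalIntegral.integral_const_mul, mul_left_comm, integral_cos_signedSum]
    split_ifs <;> simp
  rw [Finset.sum_filter, Finset.sum_congr rfl fun σ _ => h σ, ← Finset.mul_sum,
    ← intervalIntegral.integral_finsetSum]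
  · simp only [sum_exp_mul_cos]
    rw [intervalIntegral.integral_const_mul, spinProb]
    ring
  · intro σ _
    exact Continuous.intervalIntegrable (by fun_prop) _ _

open Classical in
theorem P_eq_sum_div (d : ℕ) (β h : ℝ) (n : ℕ) :
    P d β h n = (∑ σ : Config n with signedSum σ = 1, weight d β h σ)
      / ∑ σ : Config n, weight d β h σ := by
  rw [P, eventProb, Finset.sum_div]
  rfl

/-- The rate function of the mixing field: `exp (-n * rate b h t)` is, up to a constant, the density
of the external field `t` in the representation of the Curie-Weiss model as a mixture. -/
noncomputable def rate (b h t : ℝ) : ℝ := (t - h) ^ 2 / (2 * b) - Real.log (Real.cosh t)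

theorem exp_neg_rate (b h t : ℝ) (n : ℕ) :
    Real.exp (-(n * rate b h t)) = Real.exp (-(n / (2 * b)) * (t - h) ^ 2) * Real.cosh t ^ n := by
  have e : Real.cosh t ^ n = Real.exp (n * Real.log (Real.cosh t)) := by
    rw [Real.exp_nat_mul, Real.exp_log (Real.cosh_pos t)]
  rw [e, ← Real.exp_add, rate]
  congr 1
  ring

theorem integral_gaussian_mul_exp {k : ℝ} (hk : 0 < k) (h S : ℝ) :
    MeasureTheory.Integrable (fun t => Real.exp (-k * (t - h) ^ 2) * Real.exp (t * S)) ∧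
    ∫ t, Real.exp (-k * (t - h) ^ 2) * Real.exp (t * S)
      = √(Real.pi / k) * Real.exp (h * S + S ^ 2 / (4 * k)) := by
  have e : ∀ t, Real.exp (-k * (t - h) ^ 2) * Real.exp (t * S)
      = Real.exp (h * S + S ^ 2 / (4 * k)) * Real.exp (-k * (t - (h + S / (2 * k))) ^ 2) := by
    intro t
    rw [← Real.exp_add, ← Real.exp_add]
    congr 1
    field_simp
    ring
  simp only [e]
  refine ⟨(integrable_gaussian_shift hk _).const_mul _, ?_⟩
  rw [MeasureTheory.integral_const_mul, integral_gaussian_shift, mul_comm]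

/-- The Hubbard-Stratonovich transformation: the Curie-Weiss weights are a Gaussian mixture of the
weights of independent spins in an external field. -/
theorem sum_weight_eq {d n : ℕ} {β : ℝ} (hb : 0 < 2 * d * β) (hn : 0 < n) (h : ℝ)
    (T : Finset (Config n)) :
    √(Real.pi / (n / (2 * (2 * d * β)))) * ∑ σ ∈ T, weight d β h σ
      = ∫ t, Real.exp (-(n / (2 * (2 * d * β))) * (t - h) ^ 2)
          * ∑ σ ∈ T, Real.exp (t * ∑ j, spin σ j) := by
  have hn0 : (0 : ℝ) < n := by exact_mod_cast hn
  have hk : 0 < (n : ℝ) / (2 * (2 * d * β)) := by positivity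
  simp only [Finset.mul_sum]
  rw [MeasureTheory.integral_finsetSum]
  · refine Finset.sum_congr rfl fun σ _ => ?_
    have := (integral_gaussian_mul_exp hk h (∑ j, spin σ j)).2
    simp only [Finset.mul_sum] at this
    rw [this, weight]
    simp only [← Finset.mul_sum]
    congr 2
    field_simp
    ring
  · intro σ _
    have := (integral_gaussian_mul_exp hk h (∑ j, spin σ j)).1
    simpa only [Finset.mul_sum] using this

open Classical in
theorem P_eq_gibbsMean {d : ℕ} {β : ℝ} (hb : 0 < 2 * d * β) (h : ℝ) (m : ℕ) :
    P d β h (2 * m + 1) = gibbsMean (rate (2 * d * β) h) (2 * m + 1) (spinProb m) := by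
  have hn : 0 < 2 * m + 1 := by omega
  have hn0 : (0 : ℝ) < (2 * m + 1 : ℕ) := by exact_mod_cast hn
  have hk : 0 < √(Real.pi / ((2 * m + 1 : ℕ) / (2 * (2 * d * β)))) := by positivity
  have h1 := sum_weight_eq hb hn h Finset.univ
  have h2 := sum_weight_eq hb hn h (Finset.univ.filter fun σ => signedSum σ = 1)
  simp only [sum_exp_mul_spin] at h1
  simp only [sum_exp_signedSum] at h2
  have e1 : ∀ t, Real.exp (-((2 * m + 1 : ℕ) / (2 * (2 * d * β))) * (t - h) ^ 2)
        * (2 * Real.cosh t) ^ (2 * m + 1)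
      = 2 ^ (2 * m + 1) * Real.exp (-((2 * m + 1 : ℕ) * rate (2 * d * β) h t)) := by
    intro t
    rw [exp_neg_rate, mul_pow]; ring
  have e2 : ∀ t, Real.exp (-((2 * m + 1 : ℕ) / (2 * (2 * d * β))) * (t - h) ^ 2)
        * ((2 * Real.cosh t) ^ (2 * m + 1) * spinProb m t)
      = 2 ^ (2 * m + 1)
        * (spinProb m t * Real.exp (-((2 * m + 1 : ℕ) * rate (2 * d * β) h t))) := by
    intro t
    rw [exp_neg_rate, mul_pow]; ring
  simp only [e1, MeasureTheory.integral_const_mul] at h1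
  simp only [e2, MeasureTheory.integral_const_mul] at h2
  rw [P_eq_sum_div, ← mul_div_mul_left _ _ hk.ne', h1, h2, gibbsMean,
    mul_div_mul_left _ _ (by positivity)]

theorem P_eq_spinProb (d : ℕ) (h : ℝ) (m : ℕ) : P d 0 h (2 * m + 1) = spinProb m h := by
  have hw : ∀ σ : Config (2 * m + 1), weight d 0 h σ = Real.exp (h * ∑ j, spin σ j) := by
    intro σ; simp [weight]
  have hc := Real.cosh_pos h
  rw [P_eq_sum_div]
  simp only [hw]
  rw [sum_exp_mul_spin, sum_exp_signedSum, mul_div_cancel_left₀ _ (by positivity)]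

/-! ### The rate function away from criticality -/

theorem continuous_log_cosh : Continuous fun t => Real.log (Real.cosh t) :=
  continuous_iff_continuousAt.2 fun t => (hasDerivAt_log_cosh t).continuousAt

theorem continuous_rate (b h : ℝ) : Continuous (rate b h) := by
  have h1 := continuous_log_cosh
  unfold rate
  fun_prop

theorem hasDerivAt_rate (b h t : ℝ) : HasDerivAt (rate b h) ((t - h) / b - Real.tanh t) t := by
  refine (((((hasDerivAt_id t).sub_const h).fun_pow 2).div_const (2 * b)).fun_sub
    (hasDerivAt_log_cosh t)).congr_deriv ?_
  rcases eq_or_ne b 0 with rfl | hb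
  · simp
  · simp
    field_simp

/-- The second derivative of the rate function is at most `1 / b`. -/
theorem rate_sub_le {b h a : ℝ} (ha : (a - h) / b = Real.tanh a) (t : ℝ) :
    rate b h t - rate b h a ≤ 1 / (2 * b) * (t - a) ^ 2 := by
  have h1 := log_cosh_tangent_le a t
  have e : (t - h) ^ 2 / (2 * b) - (a - h) ^ 2 / (2 * b)
      = 1 / (2 * b) * (t - a) ^ 2 + (a - h) / b * (t - a) := by ring
  rw [ha] at e
  unfold rate
  linarith

theorem integrable_exp_abs_mul_gaussian {k : ℝ} (hk : 0 < k) (A h : ℝ) :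
    MeasureTheory.Integrable fun t : ℝ => Real.exp (A * |t|) * Real.exp (-k * (t - h) ^ 2) := by
  have h1 := (integral_gaussian_mul_exp hk h A).1
  have h2 := (integral_gaussian_mul_exp hk h (-A)).1
  refine (h1.add h2).mono' (by fun_prop) (Eventually.of_forall fun t => ?_)
  rw [Real.norm_eq_abs, abs_of_pos (by positivity)]
  simp only [Pi.add_apply]
  rw [← mul_add, mul_comm]
  refine mul_le_mul_of_nonneg_left ?_ (Real.exp_pos _).le
  rcases abs_choice t with h | h <;> rw [h]
  · rw [mul_comm A]; linarith [Real.exp_pos (t * -A)]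
  · rw [mul_neg, ← neg_mul, mul_comm (-A)]; linarith [Real.exp_pos (t * A)]

/-- Integrability needs `b > 0` only; the factor `cosh t ^ n` grows at most exponentially. -/
theorem integrable_exp_rate {b : ℝ} (hb : 0 < b) (h A : ℝ) {n : ℕ} (hn : 1 ≤ n) :
    MeasureTheory.Integrable fun t => Real.exp (A * |t|) * Real.exp (-(n * rate b h t)) := by
  have hn0 : (0 : ℝ) < n := by exact_mod_cast hn
  have hc := continuous_rate b h
  refine (integrable_exp_abs_mul_gaussian (k := n / (2 * b)) (by positivity) (A + n) h).mono'
    (by fun_prop) (Eventually.of_forall fun t => ?_)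
  rw [Real.norm_eq_abs, abs_of_pos (by positivity), exp_neg_rate]
  have h1 : Real.cosh t ^ n ≤ Real.exp (n * |t|) := by
    rw [Real.exp_nat_mul]
    exact pow_le_pow_left₀ (Real.cosh_pos t).le (cosh_le_exp_abs t) n
  rw [add_mul, Real.exp_add]
  calc _ ≤ Real.exp (A * |t|) * (Real.exp (-(n / (2 * b)) * (t - h) ^ 2) * Real.exp (n * |t|)) := by
        gcongr
    _ = _ := by ring

theorem integrable_mul_rate {b : ℝ} (hb : 0 < b) (h : ℝ) {A C : ℝ} {n : ℕ} (hn : 1 ≤ n)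
    {g : ℝ → ℝ} (hg : Continuous g) (hgb : ∀ t, |g t| ≤ C * Real.exp (A * |t|)) :
    MeasureTheory.Integrable fun t => g t * Real.exp (-(n * rate b h t)) := by
  have hc := continuous_rate b h
  refine ((integrable_exp_rate hb h A hn).const_mul C).mono' (by fun_prop)
    (Eventually.of_forall fun t => ?_)
  rw [Real.norm_eq_abs, abs_mul, abs_of_pos (Real.exp_pos (-(n * rate b h t))), ← mul_assoc]
  exact mul_le_mul_of_nonneg_right (hgb t) (Real.exp_pos _).le

theorem integral_exp_rate_pos {b : ℝ} (hb : 0 < b) (h : ℝ) {n : ℕ} (hn : 1 ≤ n) :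
    0 < ∫ t, Real.exp (-(n * rate b h t)) := by
  have h1 := integrable_exp_rate hb h 0 hn
  simp only [zero_mul, Real.exp_zero, one_mul] at h1
  exact MeasureTheory.integral_exp_pos h1

/-- Changing the sign of `h` reflects the mixing density. -/
theorem gibbsMean_rate_abs (b h : ℝ) (n : ℕ) {g : ℝ → ℝ} (hg : ∀ t, g (-t) = g t) :
    gibbsMean (rate b h) n g = gibbsMean (rate b |h|) n g := by
  rcases abs_choice h with e | e
  · rw [e]
  · have hr : ∀ t, rate b h (-t) = rate b (-h) t := by
      intro t
      simp only [rate, Real.cosh_neg]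
      ring
    rw [e, gibbsMean, gibbsMean,
      ← MeasureTheory.integral_neg_eq_self (fun t => g t * Real.exp (-(n * rate b h t))),
      ← MeasureTheory.integral_neg_eq_self (fun t => Real.exp (-(n * rate b h t)))]
    simp only [hr, hg]

/-- The local limit theorem, integrated over the mixing density. -/
theorem exists_abs_gibbsMean_spinProb_sub_le : ∃ C : ℝ, 0 < C ∧ ∀ {b : ℝ}, 0 < b → ∀ h : ℝ,
    ∀ m : ℕ, 1 ≤ m →
    |gibbsMean (rate b h) (2 * m + 1) (spinProb m)
        - √(2 / Real.pi) / √(2 * m + 1) * gibbsMean (rate b h) (2 * m + 1) Real.cosh| ≤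
      C / ((2 * m + 1) * √(2 * m + 1)) *
        gibbsMean (rate b h) (2 * m + 1) (fun t => Real.exp (3 * |t|)) := by
  obtain ⟨C, hC, hb⟩ := exists_abs_spinProb_sub_le
  refine ⟨C, hC, fun {b} hb0 h m hm => ?_⟩
  have hn : 1 ≤ 2 * m + 1 := by omega
  set N : ℝ := 2 * m + 1 with hN
  have hN0 : 0 < N := by positivity
  set q := spinProb m with hq
  set E : ℝ → ℝ := fun t => Real.exp (-((2 * m + 1 : ℕ) * rate b h t)) with hE
  have hZ : 0 < ∫ t, E t := integral_exp_rate_pos hb0 h hn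
  have hEpos : ∀ t, 0 < E t := fun t => Real.exp_pos _
  have hqc : Continuous q := continuous_spinProb m
  have icosh : MeasureTheory.Integrable fun t => Real.cosh t * E t :=
    integrable_mul_rate hb0 h (A := 1) (C := 1) hn Real.continuous_cosh fun t => by
      rw [abs_of_pos (Real.cosh_pos t), one_mul, one_mul]; exact cosh_le_exp_abs t
  have iexp : MeasureTheory.Integrable fun t => Real.exp (3 * |t|) * E t :=
    integrable_exp_rate hb0 h 3 hn
  have idiff : MeasureTheory.Integrable
      fun t => (q t - √(2 / Real.pi) * Real.cosh t / √N) * E t := by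
    refine integrable_mul_rate hb0 h (A := 3) (C := C / (N * √N)) hn ?_ fun t => ?_
    · have := Real.continuous_cosh
      fun_prop
    · rw [div_mul_eq_mul_div]; exact hb m hm t
  have iq : MeasureTheory.Integrable fun t => q t * E t := by
    refine (idiff.add (icosh.const_mul (√(2 / Real.pi) / √N))).congr
      (Eventually.of_forall fun t => ?_)
    simp only [Pi.add_apply]
    ring
  have e : gibbsMean (rate b h) (2 * m + 1) q
        - √(2 / Real.pi) / √N * gibbsMean (rate b h) (2 * m + 1) Real.cosh
      = (∫ t, (q t - √(2 / Real.pi) * Real.cosh t / √N) * E t) / ∫ t, E t := by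
    have e1 : ∀ t, (q t - √(2 / Real.pi) * Real.cosh t / √N) * E t
        = q t * E t - √(2 / Real.pi) / √N * (Real.cosh t * E t) := fun t => by ring
    simp only [e1]
    rw [MeasureTheory.integral_sub iq (icosh.const_mul _), MeasureTheory.integral_const_mul,
      gibbsMean, gibbsMean]
    ring
  rw [e, abs_div, abs_of_pos hZ, gibbsMean, ← mul_div_assoc]
  refine div_le_div_of_nonneg_right ?_ hZ.le
  rw [← MeasureTheory.integral_const_mul]
  refine MeasureTheory.abs_integral_le_integral_abs.trans
    (MeasureTheory.integral_mono idiff.abs (iexp.const_mul _) fun t => ?_)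
  simp only
  rw [abs_mul, abs_of_pos (hEpos t), ← mul_assoc, div_mul_eq_mul_div]
  exact mul_le_mul_of_nonneg_right (hb m hm t) (hEpos t).le

/-- Above the critical temperature and without field, the mixing density concentrates at `0`. -/
theorem quadraticWell_rate_zero {b : ℝ} (hb : 0 < b) (hb1 : b < 1) :
    QuadraticWell (fun t => rate b 0 t - rate b 0 0) 0 (1 / (2 * b) - 1 / 2) (1 / (2 * b)) where
  continuous := (continuous_rate b 0).sub continuous_const
  a_nonneg := le_rfl
  c_pos := by
    rw [sub_pos]
    exact one_div_lt_one_div_of_lt (by positivity) (by linarith)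
  K_pos := by positivity
  lower t := by
    have h1 := log_cosh_le_sq_div_two_sub t
    have h2 : 0 ≤ t ^ 4 / (12 * (1 + t ^ 2)) := by positivity
    have e : (1 / (2 * b) - 1 / 2) * (|t| - 0) ^ 2 = t ^ 2 / (2 * b) - t ^ 2 / 2 := by
      rw [sub_zero, sq_abs]; ring
    rw [e]
    simp [rate]
    linarith
  upper t := rate_sub_le (by simp) t

/-- A positive critical point `a` of the rate function with `h ≥ 0` is a global minimum. -/
theorem exists_rate_sub_ge {b h a : ℝ} (hb : 0 < b) (ha : 0 < a)
    (hab : (a - h) / b = Real.tanh a) : ∃ c > 0, ∀ t,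
      c * (|t| - a) ^ 2 + h / (2 * b * a) * (t - a) ^ 2 ≤ rate b h t - rate b h a := by
  obtain ⟨c, hc, H⟩ := exists_log_cosh_le_parabola ha
  refine ⟨c, hc, fun t => ?_⟩
  have h1 := H t
  rw [← hab] at h1
  have e : (t - h) ^ 2 / (2 * b) - (a - h) ^ 2 / (2 * b)
      = (a - h) / b / a * ((t ^ 2 - a ^ 2) / 2) + h / (2 * b * a) * (t - a) ^ 2 := by
    field_simp; ring
  unfold rate
  linarith

theorem quadraticWell_rate {b h a c : ℝ} (hb : 0 < b) (hh : 0 ≤ h) (ha : 0 < a) (hc : 0 < c)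
    (hab : (a - h) / b = Real.tanh a)
    (H : ∀ t, c * (|t| - a) ^ 2 + h / (2 * b * a) * (t - a) ^ 2 ≤ rate b h t - rate b h a) :
    QuadraticWell (fun t => rate b h t - rate b h a) a c (1 / (2 * b)) where
  continuous := (continuous_rate b h).sub continuous_const
  a_nonneg := ha.le
  c_pos := hc
  K_pos := by positivity
  lower t := by
    have := H t
    have : 0 ≤ h / (2 * b * a) * (t - a) ^ 2 := by positivity
    linarith
  upper t := rate_sub_le hab t

theorem exists_gibbsMean_rate_exp_le {b h a c K : ℝ}
    (w : QuadraticWell (fun t => rate b h t - rate b h a) a c K) (A : ℝ) :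
    ∃ C : ℝ, 0 < C ∧ ∀ n : ℕ, 1 ≤ n →
      gibbsMean (rate b h) n (fun t => Real.exp (A * |t|)) ≤ C := by
  obtain ⟨C, hC, H⟩ := w.exists_gibbsMean_exp_le A
  refine ⟨C, hC, fun n hn => ?_⟩
  rw [← gibbsMean_sub_const _ _ _ (rate b h a), gibbsMean, div_le_iff₀ (w.integral_weight_pos hn)]
  exact H n hn

theorem abs_cosh_le (t : ℝ) {A : ℝ} (hA : 1 ≤ A) : |Real.cosh t| ≤ Real.exp (A * |t|) := by
  rw [abs_of_pos (Real.cosh_pos t)]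
  refine (cosh_le_exp_abs t).trans (Real.exp_le_exp.2 ?_)
  nlinarith [abs_nonneg t]

/-- Here `cosh` has no first-order term at the minimum, so no integration by parts is needed and
`ξ = 0`. -/
theorem exists_abs_gibbsMean_cosh_sub_one_le {b : ℝ} (hb : 0 < b) (hb1 : b < 1) :
    ∃ D : ℝ, ∀ n : ℕ, 1 ≤ n → |gibbsMean (rate b 0) n Real.cosh - 1| ≤ D / n := by
  have w := quadraticWell_rate_zero hb hb1
  set c := 1 / (2 * b) - 1 / 2 with hc
  have hc0 : 0 < c := w.c_pos
  have h1 : 0 < 1 / c := by positivity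
  obtain ⟨D, hD⟩ := w.exists_abs_gibbsMean_sub_le (A := 1) (C := 1 + 1 / c) (g := Real.cosh)
    (g₀ := 1) (α := 0) (ξ := fun _ => 0) (ξ' := fun _ => 0)
    (fun t => (hasDerivAt_rate b 0 t).sub_const _) (fun t => hasDerivAt_const t 0)
    (by have := continuous_tanh; fun_prop) continuous_const Real.continuous_cosh
    (fun t => by simp; positivity) (fun t => by simp; positivity) (fun t => by simp; positivity)
    (fun t => by
      refine (abs_cosh_le t le_rfl).trans (le_mul_of_one_le_left (Real.exp_pos _).le (by linarith)))
    (fun t => by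
      have h2 := abs_cosh_taylor 0 t
      have h3 := w.lower t
      have h4 : t ^ 2 ≤ 1 / c * (rate b 0 t - rate b 0 0) := by
        rw [one_div_mul_eq_div, le_div_iff₀ hc0]
        rw [sub_zero, sq_abs] at h3
        linarith
      have h5 := w.nonneg t
      simp only [Real.cosh_zero, Real.sinh_zero, abs_zero, Real.exp_zero, zero_mul, sub_zero,
        one_mul] at h2 ⊢
      calc _ ≤ Real.exp |t| * t ^ 2 := h2
        _ ≤ Real.exp |t| * ((1 + 1 / c) * (rate b 0 t - rate b 0 0)) := by
            gcongr
            linarith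
        _ = _ := by ring)
  refine ⟨D, fun n hn => ?_⟩
  rw [← gibbsMean_sub_const _ _ _ (rate b 0 0)]
  exact hD n hn

/-- The second derivative of the rate function at a positive critical point is positive. -/
theorem rate_curvature_pos {b h a : ℝ} (hb : 0 < b) (hh : 0 ≤ h) (ha : 0 < a)
    (hab : (a - h) / b = Real.tanh a) : 0 < 1 / b - (1 - Real.tanh a ^ 2) := by
  have h1 := mul_sech_sq_lt_tanh ha
  have h2 := one_sub_tanh_sq_pos a
  have h3 : 0 < Real.tanh a := (by positivity : 0 ≤ a * (1 - Real.tanh a ^ 2)).trans_lt h1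
  rw [← hab] at h1 h3
  have h4 : 0 < a - h := by
    by_contra hn
    exact absurd h3 (not_lt.2 (div_nonpos_of_nonpos_of_nonneg (not_lt.1 hn) hb.le))
  rw [← hab] at h2 ⊢
  rw [sub_pos, lt_div_iff₀ hb]
  rw [lt_div_iff₀ hb] at h1
  have h5 : 0 < (1 - ((a - h) / b) ^ 2) * b := by positivity
  nlinarith

theorem abs_rate_deriv_le {b h a : ℝ} (hb : 0 < b) (hab : (a - h) / b = Real.tanh a) (t : ℝ) :
    |(t - h) / b - Real.tanh t| ≤ (1 / b + 1) * |t - a| := by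
  have e : (t - h) / b - Real.tanh t = 1 / b * (t - a) - (Real.tanh t - Real.tanh a) := by
    rw [← hab]; ring
  rw [e]
  refine (abs_sub _ _).trans ?_
  rw [abs_mul, abs_of_pos (by positivity : 0 < 1 / b)]
  linarith [abs_tanh_sub_le t a]

/-- At a nondegenerate critical point `a`, the first-order term of `cosh` is a multiple of the
derivative of the rate function. -/
theorem abs_cosh_sub_rate_deriv_le {b h a k : ℝ} (hab : (a - h) / b = Real.tanh a)
    (hk : k = 1 / b - (1 - Real.tanh a ^ 2)) (hk0 : 0 < k) (t : ℝ) :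
    |Real.cosh t - Real.cosh a - Real.sinh a / k * ((t - h) / b - Real.tanh t)| ≤
      (Real.exp |a| + 2 * |Real.sinh a / k|) * Real.exp |t| * (t - a) ^ 2 := by
  have h1 := abs_cosh_taylor a t
  have h2 := abs_tanh_taylor a t
  have e : Real.cosh t - Real.cosh a - Real.sinh a / k * ((t - h) / b - Real.tanh t)
      = (Real.cosh t - Real.cosh a - Real.sinh a * (t - a))
        + Real.sinh a / k * (Real.tanh t - Real.tanh a - (1 - Real.tanh a ^ 2) * (t - a)) := by
    have e1 : (t - h) / b - Real.tanh t
        = k * (t - a) - (Real.tanh t - Real.tanh a - (1 - Real.tanh a ^ 2) * (t - a)) := by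
      have e2 : (t - h) / b = (t - a) / b + Real.tanh a := by rw [← hab]; ring
      rw [e2, hk]; ring
    rw [e1]
    field_simp
    ring
  rw [e]
  refine (abs_add_le _ _).trans ?_
  rw [abs_mul (Real.sinh a / k)]
  have h3 := mul_le_mul_of_nonneg_left h2 (abs_nonneg (Real.sinh a / k))
  have h4 : 1 ≤ Real.exp |t| := Real.one_le_exp (abs_nonneg t)
  have h5 : |Real.sinh a / k| * (2 * (t - a) ^ 2)
      ≤ |Real.sinh a / k| * (2 * (t - a) ^ 2) * Real.exp |t| :=
    le_mul_of_one_le_right (by positivity) h4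
  linarith

theorem abs_sub_le_exp {a : ℝ} (ha : 0 < a) (t : ℝ) : |t - a| ≤ (1 + a) * Real.exp |t| := by
  have h1 := Real.add_one_le_exp |t|
  have h2 : |t - a| ≤ |t| + |a| := abs_sub _ _
  rw [abs_of_pos ha] at h2
  have h3 : 1 ≤ Real.exp |t| := Real.one_le_exp (abs_nonneg t)
  nlinarith

/-- With a positive field the minimum is unique and `ξ = 1` serves as multiplier. -/
theorem exists_abs_gibbsMean_cosh_sub_le_of_pos {b h a : ℝ} (hb : 0 < b) (hh : 0 < h) (ha : 0 < a)
    (hab : (a - h) / b = Real.tanh a) :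
    ∃ D : ℝ, ∀ n : ℕ, 1 ≤ n → |gibbsMean (rate b h) n Real.cosh - Real.cosh a| ≤ D / n := by
  obtain ⟨c, hc, H⟩ := exists_rate_sub_ge hb ha hab
  have w := quadraticWell_rate hb hh.le ha hc hab H
  have hk0 := rate_curvature_pos hb hh.le ha hab
  set k := 1 / b - (1 - Real.tanh a ^ 2) with hk
  set M := Real.exp |a| + 2 * |Real.sinh a / k| with hM
  have hM0 : 0 < M := by positivity
  set γ := h / (2 * b * a) with hγ
  have hγ0 : 0 < γ := by positivity
  have hC1 : 0 < (1 / b + 1) * (1 + a) := by positivity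
  have hC2 : 0 < M / γ := by positivity
  obtain ⟨D, hD⟩ := w.exists_abs_gibbsMean_sub_le (A := 1)
    (C := 1 + (1 / b + 1) * (1 + a) + M / γ) (g := Real.cosh)
    (g₀ := Real.cosh a) (α := Real.sinh a / k) (ξ := fun _ => 1) (ξ' := fun _ => 0)
    (fun t => (hasDerivAt_rate b h t).sub_const _) (fun t => hasDerivAt_const t 1)
    (by have := continuous_tanh; fun_prop) continuous_const Real.continuous_cosh
    (fun t => by
      have : 1 ≤ Real.exp (1 * |t|) := Real.one_le_exp (by positivity)
      rw [abs_one]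
      nlinarith)
    (fun t => by simp; positivity)
    (fun t => by
      simp only [one_mul]
      refine (abs_rate_deriv_le hb hab t).trans ?_
      have h1 := mul_le_mul_of_nonneg_left (abs_sub_le_exp ha t) (by positivity : 0 ≤ 1 / b + 1)
      have h2 := Real.exp_pos |t|
      nlinarith)
    (fun t => by
      refine (abs_cosh_le t le_rfl).trans (le_mul_of_one_le_left (Real.exp_pos _).le (by linarith)))
    (fun t => by
      have h1 := abs_cosh_sub_rate_deriv_le hab hk hk0 t
      have h3 := H t
      have h4 : (t - a) ^ 2 ≤ (rate b h t - rate b h a) / γ := by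
        rw [le_div_iff₀ hγ0]
        have : 0 ≤ c * (|t| - a) ^ 2 := by positivity
        linarith
      have h5 := w.nonneg t
      simp only [one_mul]
      rw [← hM] at h1
      have h6 := Real.exp_pos |t|
      calc _ ≤ M * Real.exp |t| * (t - a) ^ 2 := h1
        _ ≤ M * Real.exp |t| * ((rate b h t - rate b h a) / γ) := by gcongr
        _ = M / γ * ((rate b h t - rate b h a) * Real.exp |t|) := by ring
        _ ≤ _ := by
          refine mul_le_mul_of_nonneg_right (by linarith) (mul_nonneg h5 h6.le))
  refine ⟨D, fun n hn => ?_⟩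
  rw [← gibbsMean_sub_const _ _ _ (rate b h a)]
  exact hD n hn

/-- Without field the minima are `a` and `-a`. The multiplier `ξ = t` makes `ξ f'` even, so that it
represents the first-order term of `cosh` at both of them. -/
theorem exists_abs_gibbsMean_cosh_sub_le_of_zero {b a : ℝ} (hb : 0 < b) (ha : 0 < a)
    (hab : a / b = Real.tanh a) :
    ∃ D : ℝ, ∀ n : ℕ, 1 ≤ n → |gibbsMean (rate b 0) n Real.cosh - Real.cosh a| ≤ D / n := by
  have hab' : (a - 0) / b = Real.tanh a := by rw [sub_zero, hab]
  obtain ⟨c, hc, H⟩ := exists_rate_sub_ge hb ha hab'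
  have w := quadraticWell_rate hb le_rfl ha hc hab' H
  have hk0 := rate_curvature_pos hb le_rfl ha hab'
  set k := 1 / b - (1 - Real.tanh a ^ 2) with hk
  set M := Real.exp |a| + 2 * |Real.sinh a / k| with hM
  set M' := M + |Real.sinh a / k| / a * (1 / b + 1) with hM'
  have hM0 : 0 < M := by positivity
  have hM'0 : 0 < M' := by positivity
  have hC1 : 0 < (1 / b + 1) * (1 + a) := by positivity
  have hC2 : 0 < M' / c := by positivity
  have hexp2 : ∀ t : ℝ, Real.exp (2 * |t|) = Real.exp |t| * Real.exp |t| := fun t => by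
    rw [← Real.exp_add]; congr 1; ring
  have hloc : ∀ t, |Real.cosh t - Real.cosh a
        - Real.sinh a / k / a * (t * ((t - 0) / b - Real.tanh t))|
      ≤ M' * Real.exp |t| * (|t| - a) ^ 2 := by
    intro t
    wlog ht : 0 ≤ t generalizing t
    · have := this (-t) (by linarith)
      rw [Real.cosh_neg, Real.tanh_neg, abs_neg] at this
      convert this using 3
      ring
    have h1 := abs_cosh_sub_rate_deriv_le hab' hk hk0 t
    rw [← hM] at h1
    have h2 := abs_rate_deriv_le hb hab' t
    rw [abs_of_nonneg ht] at h1 ⊢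
    set u := (t - 0) / b - Real.tanh t with hu
    have e : Real.cosh t - Real.cosh a - Real.sinh a / k / a * (t * u)
        = (Real.cosh t - Real.cosh a - Real.sinh a / k * u)
          - Real.sinh a / k / a * ((t - a) * u) := by
      field_simp; ring
    rw [e]
    refine (abs_sub _ _).trans ?_
    rw [abs_mul (Real.sinh a / k / a), abs_mul (t - a), abs_div (Real.sinh a / k) a, abs_of_pos ha]
    have h3 : |t - a| * |u| ≤ (1 / b + 1) * (t - a) ^ 2 := by
      have := mul_le_mul_of_nonneg_left h2 (abs_nonneg (t - a))
      rw [← sq_abs (t - a)]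
      linarith
    have h4 := mul_le_mul_of_nonneg_left h3 (by positivity : 0 ≤ |Real.sinh a / k| / a)
    have h5 : |Real.sinh a / k| / a * ((1 / b + 1) * (t - a) ^ 2)
      ≤ |Real.sinh a / k| / a * ((1 / b + 1) * (t - a) ^ 2) * Real.exp t :=
      le_mul_of_one_le_right (by positivity) (Real.one_le_exp ht)
    rw [hM']
    linarith
  obtain ⟨D, hD⟩ := w.exists_abs_gibbsMean_sub_le (A := 2)
    (C := 1 + (1 / b + 1) * (1 + a) + M' / c) (g := Real.cosh)
    (g₀ := Real.cosh a) (α := Real.sinh a / k / a) (ξ := fun t => t) (ξ' := fun _ => 1)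
    (fun t => (hasDerivAt_rate b 0 t).sub_const _) (fun t => hasDerivAt_id t)
    (by have := continuous_tanh; fun_prop) continuous_const Real.continuous_cosh
    (fun t => by
      have h1 := Real.add_one_le_exp (2 * |t|)
      have := abs_nonneg t
      have := Real.exp_pos (2 * |t|)
      nlinarith)
    (fun t => by
      have : 1 ≤ Real.exp (2 * |t|) := Real.one_le_exp (by positivity)
      rw [abs_one]
      nlinarith)
    (fun t => by
      rw [abs_mul]
      have h1 := mul_le_mul_of_nonneg_left (abs_sub_le_exp ha t) (by positivity : 0 ≤ 1 / b + 1)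
      have h2 := (abs_rate_deriv_le hb hab' t).trans h1
      have h3 : |t| ≤ Real.exp |t| := by linarith [Real.add_one_le_exp |t|]
      have h4 := mul_le_mul h3 h2 (abs_nonneg _) (Real.exp_pos _).le
      have h5 := Real.exp_pos (2 * |t|)
      have e : Real.exp |t| * ((1 / b + 1) * ((1 + a) * Real.exp |t|))
          = (1 / b + 1) * (1 + a) * Real.exp (2 * |t|) := by rw [hexp2]; ring
      rw [e] at h4
      nlinarith)
    (fun t => by
      refine (abs_cosh_le t one_le_two).trans
        (le_mul_of_one_le_left (Real.exp_pos _).le (by linarith)))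
    (fun t => by
      have h3 := w.lower t
      have h4 : (|t| - a) ^ 2 ≤ (rate b 0 t - rate b 0 a) / c := by
        rw [le_div_iff₀ hc]
        linarith
      have h5 := w.nonneg t
      have h6 := Real.exp_pos |t|
      have h7 : Real.exp |t| ≤ Real.exp (2 * |t|) :=
        Real.exp_le_exp.2 (by linarith [abs_nonneg t])
      calc _ ≤ M' * Real.exp |t| * (|t| - a) ^ 2 := hloc t
        _ ≤ M' * Real.exp (2 * |t|) * ((rate b 0 t - rate b 0 a) / c) := by gcongr
        _ = M' / c * ((rate b 0 t - rate b 0 a) * Real.exp (2 * |t|)) := by ring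
        _ ≤ _ := by
          refine mul_le_mul_of_nonneg_right (by linarith)
            (mul_nonneg h5 (Real.exp_pos _).le))
  refine ⟨D, fun n hn => ?_⟩
  rw [← gibbsMean_sub_const _ _ _ (rate b 0 a)]
  exact hD n hn

/-! ### The critical point -/

theorem critical_rate_le (t : ℝ) : rate 1 0 t ≤ t ^ 4 / 12 := by
  have := sq_div_two_sub_le_log_cosh t
  simp [rate]
  linarith

theorem le_critical_rate (t : ℝ) : t ^ 4 / (12 * (1 + t ^ 2)) ≤ rate 1 0 t := by
  have := log_cosh_le_sq_div_two_sub t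
  simp [rate]
  linarith

theorem sq_div_two_le_cosh_sub_one (x : ℝ) : x ^ 2 / 2 ≤ Real.cosh x - 1 := by
  have h1 : x ^ 2 ≤ 4 * Real.sinh (x / 2) ^ 2 := by
    have h2 : |x / 2| ≤ |Real.sinh (x / 2)| := by
      rw [Real.abs_sinh]
      exact Real.self_le_sinh_iff.2 (abs_nonneg _)
    have := sq_le_sq.2 h2
    linarith
  have h3 := Real.cosh_two_mul (x / 2)
  have h4 := Real.cosh_sq (x / 2)
  rw [show 2 * (x / 2) = x by ring] at h3
  linarith

theorem cosh_sub_one_le (x : ℝ) : Real.cosh x - 1 ≤ x ^ 2 / 2 * Real.exp (x ^ 2 / 2) := by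
  have h1 := Real.cosh_le_exp_half_sq x
  have h2 := Real.one_sub_le_exp_neg (x ^ 2 / 2)
  have h3 : Real.exp (x ^ 2 / 2) * Real.exp (-(x ^ 2 / 2)) = 1 := by
    rw [← Real.exp_add]; simp
  have h4 := mul_le_mul_of_nonneg_left h2 (Real.exp_pos (x ^ 2 / 2)).le
  rw [h3] at h4
  linarith

/-- The scale `n ^ (-1/4)` of the mixing field at criticality. -/
noncomputable def critScale (n : ℕ) : ℝ := (n : ℝ) ^ (-(1 / 4) : ℝ)

theorem critScale_pos {n : ℕ} (hn : 1 ≤ n) : 0 < critScale n := by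
  have : (0 : ℝ) < n := by exact_mod_cast hn
  exact Real.rpow_pos_of_pos this _

theorem critScale_le_one {n : ℕ} (hn : 1 ≤ n) : critScale n ≤ 1 := by
  have : (1 : ℝ) ≤ n := by exact_mod_cast hn
  exact Real.rpow_le_one_of_one_le_of_nonpos this (by norm_num)

theorem sqrt_mul_critScale_sq {n : ℕ} (hn : 1 ≤ n) : √n * critScale n ^ 2 = 1 := by
  have : (0 : ℝ) < n := by exact_mod_cast hn
  rw [critScale, ← Real.rpow_natCast, ← Real.rpow_mul this.le, Real.sqrt_eq_rpow,
    ← Real.rpow_add this]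
  norm_num

theorem mul_critScale_pow_four {n : ℕ} (hn : 1 ≤ n) : n * critScale n ^ 4 = 1 := by
  have h := sqrt_mul_critScale_sq hn
  have h2 := Real.mul_self_sqrt (Nat.cast_nonneg (α := ℝ) n)
  calc n * critScale n ^ 4 = (√n * critScale n ^ 2) ^ 2 := by rw [← h2]; ring_nf; simp; ring
    _ = 1 := by rw [h, one_pow]

theorem tendsto_critScale : Tendsto critScale atTop (𝓝 0) :=
  (tendsto_rpow_neg_atTop (by norm_num : (0 : ℝ) < 1 / 4)).comp tendsto_natCast_atTop_atTop

theorem gibbsMean_comp_mul (f : ℝ → ℝ) (n : ℕ) (g : ℝ → ℝ) {r : ℝ} (hr : 0 < r) :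
    gibbsMean (fun y => f (r * y)) n (fun y => g (r * y)) = gibbsMean f n g := by
  rw [gibbsMean, gibbsMean, MeasureTheory.Measure.integral_comp_mul_left
    (fun t => g t * Real.exp (-(n * f t))), MeasureTheory.Measure.integral_comp_mul_left
    (fun t => Real.exp (-(n * f t))), smul_eq_mul, smul_eq_mul]
  exact mul_div_mul_left _ _ (by positivity)

/-- The rescaled Gibbs weight at criticality. -/
noncomputable def critWeight (n : ℕ) (y : ℝ) : ℝ := Real.exp (-(n * rate 1 0 (critScale n * y)))

theorem continuous_critWeight (n : ℕ) : Continuous (critWeight n) := by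
  have := continuous_rate 1 0
  unfold critWeight
  fun_prop

/-- A Gaussian majorant of the rescaled weights, independent of `n`. -/
theorem critWeight_le {n : ℕ} (hn : 1 ≤ n) (y : ℝ) :
    critWeight n y ≤ Real.exp (1 / 12) * Real.exp (-(1 / 12) * (y - 0) ^ 2) := by
  have h1 := le_critical_rate (critScale n * y)
  have hr := critScale_pos hn
  have hr1 := critScale_le_one hn
  have h4 := mul_critScale_pow_four hn
  set r := critScale n
  have h0 : (0 : ℝ) ≤ n := Nat.cast_nonneg n
  have h2 : (y ^ 2 - 1) / 12 ≤ n * rate 1 0 (r * y) := by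
    refine le_trans ?_ (mul_le_mul_of_nonneg_left h1 h0)
    have e : n * ((r * y) ^ 4 / (12 * (1 + (r * y) ^ 2)))
        = n * r ^ 4 * y ^ 4 / (12 * (1 + (r * y) ^ 2)) := by ring
    rw [e, h4, one_mul, div_le_div_iff₀ (by norm_num) (by positivity)]
    have h3 : (r * y) ^ 2 ≤ y ^ 2 := by
      rw [mul_pow]; exact mul_le_of_le_one_left (sq_nonneg _) (pow_le_one₀ hr.le hr1)
    rcases le_total (y ^ 2) 1 with h5 | h5
    · have : (y ^ 2 - 1) * (12 * (1 + (r * y) ^ 2)) ≤ 0 :=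
        mul_nonpos_of_nonpos_of_nonneg (by linarith) (by positivity)
      have : 0 ≤ y ^ 4 * 12 := by positivity
      linarith
    · have := mul_le_mul_of_nonneg_left h3 (sub_nonneg.2 h5)
      nlinarith
  rw [critWeight, ← Real.exp_add, Real.exp_le_exp]
  linarith

theorem tendsto_critWeight (y : ℝ) :
    Tendsto (fun n => critWeight n y) atTop (𝓝 (Real.exp (-(1 / 12) * y ^ 4))) := by
  unfold critWeight
  refine (Real.continuous_exp.tendsto _).comp ?_
  have h : Tendsto (fun n : ℕ => n * rate 1 0 (critScale n * y)) atTop (𝓝 (y ^ 4 / 12)) := by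
    have hl : Tendsto (fun n : ℕ => y ^ 4 / (12 * (1 + (critScale n * y) ^ 2))) atTop
        (𝓝 (y ^ 4 / 12)) := by
      have h1 := tendsto_critScale.mul_const y
      have h2 := (((h1.pow 2).const_add 1).const_mul 12)
      have h3 : Tendsto (fun n : ℕ => y ^ 4 / (12 * (1 + (critScale n * y) ^ 2))) atTop _ :=
        tendsto_const_nhds.div h2 (by norm_num)
      simpa using h3
    refine tendsto_of_tendsto_of_tendsto_of_le_of_le' hl tendsto_const_nhds ?_ ?_
    · filter_upwards [eventually_ge_atTop 1] with n hn
      have h4 := mul_critScale_pow_four hn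
      refine le_trans (le_of_eq ?_) (mul_le_mul_of_nonneg_left
        (le_critical_rate (critScale n * y)) (Nat.cast_nonneg n))
      calc _ = n * critScale n ^ 4 * y ^ 4 / (12 * (1 + (critScale n * y) ^ 2)) := by
            rw [h4, one_mul]
        _ = _ := by ring
    · filter_upwards [eventually_ge_atTop 1] with n hn
      have h4 := mul_critScale_pow_four hn
      refine (mul_le_mul_of_nonneg_left
        (critical_rate_le (critScale n * y)) (Nat.cast_nonneg n)).trans (le_of_eq ?_)
      calc _ = n * critScale n ^ 4 * y ^ 4 / 12 := by ring
        _ = _ := by rw [h4, one_mul]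
  convert h.neg using 2
  ring

theorem integrable_critBound (A : ℝ) : MeasureTheory.Integrable fun y : ℝ =>
    Real.exp (A * |y|) * (Real.exp (1 / 12) * Real.exp (-(1 / 12) * (y - 0) ^ 2)) := by
  have h := (integrable_exp_abs_mul_gaussian (k := 1 / 12) (by norm_num) A 0).const_mul
    (Real.exp (1 / 12))
  refine h.congr (Eventually.of_forall fun y => ?_)
  simp only
  ring

theorem tendsto_integral_critWeight : Tendsto (fun n => ∫ y, critWeight n y) atTop
    (𝓝 (∫ y : ℝ, Real.exp (-(1 / 12) * y ^ 4))) := by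
  refine MeasureTheory.tendsto_integral_filter_of_dominated_convergence
    (fun y => Real.exp (0 * |y|) * (Real.exp (1 / 12) * Real.exp (-(1 / 12) * (y - 0) ^ 2)))
    (Eventually.of_forall fun n => (continuous_critWeight n).aestronglyMeasurable) ?_
    (integrable_critBound 0) (Eventually.of_forall tendsto_critWeight)
  filter_upwards [eventually_ge_atTop 1] with n hn
  refine Eventually.of_forall fun y => ?_
  rw [Real.norm_eq_abs, zero_mul, Real.exp_zero, one_mul, critWeight, abs_of_pos (Real.exp_pos _)]
  exact critWeight_le hn y

theorem tendsto_integral_cosh_critWeight :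
    Tendsto (fun n : ℕ => ∫ y, √n * (Real.cosh (critScale n * y) - 1) * critWeight n y) atTop
      (𝓝 (∫ y : ℝ, y ^ 2 / 2 * Real.exp (-(1 / 12) * y ^ 4))) := by
  have hcosh := Real.continuous_cosh
  refine MeasureTheory.tendsto_integral_filter_of_dominated_convergence
    (fun y => Real.exp (3 * |y|) * (Real.exp (1 / 12) * Real.exp (-(1 / 12) * (y - 0) ^ 2)))
    (Eventually.of_forall fun n => ?_) ?_ (integrable_critBound 3)
    (Eventually.of_forall fun y => ?_)
  · have := continuous_critWeight n
    exact Continuous.aestronglyMeasurable (by fun_prop)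
  · filter_upwards [eventually_ge_atTop 1] with n hn
    refine Eventually.of_forall fun y => ?_
    have hr := critScale_pos hn
    have hr1 := critScale_le_one hn
    have h2 := sqrt_mul_critScale_sq hn
    have h0 : 0 ≤ Real.cosh (critScale n * y) - 1 := by
      linarith [Real.one_le_cosh (critScale n * y)]
    have hw : 0 < critWeight n y := Real.exp_pos _
    rw [Real.norm_eq_abs, abs_of_nonneg (by positivity)]
    refine mul_le_mul ?_ (critWeight_le hn y) hw.le (Real.exp_pos _).le
    have h1 := abs_cosh_taylor 0 (critScale n * y)
    simp only [Real.cosh_zero, Real.sinh_zero, abs_zero, Real.exp_zero, zero_mul, sub_zero,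
        one_mul] at h1
    rw [abs_of_nonneg h0, abs_mul, abs_of_pos hr] at h1
    have h3 : critScale n * |y| ≤ |y| := mul_le_of_le_one_left (abs_nonneg y) hr1
    have h4 : |y| ≤ Real.exp |y| := by linarith [Real.add_one_le_exp |y|]
    calc √n * (Real.cosh (critScale n * y) - 1)
        ≤ √n * (Real.exp (critScale n * |y|) * (critScale n * y) ^ 2) := by gcongr
      _ = Real.exp (critScale n * |y|) * |y| ^ 2 * (√n * critScale n ^ 2) := by
          rw [sq_abs]; ring
      _ ≤ Real.exp |y| * Real.exp |y| ^ 2 := by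
          rw [h2, mul_one]
          gcongr
      _ = Real.exp (3 * |y|) := by
          rw [← Real.exp_nat_mul, ← Real.exp_add]; congr 1; push_cast; ring
  · refine Tendsto.mul ?_ (tendsto_critWeight y)
    have hu : Tendsto (fun n : ℕ => y ^ 2 / 2 * Real.exp ((critScale n * y) ^ 2 / 2)) atTop
        (𝓝 (y ^ 2 / 2)) := by
      have h1 := ((tendsto_critScale.mul_const y).pow 2).div_const 2
      have h2 := ((Real.continuous_exp.tendsto _).comp h1).const_mul (y ^ 2 / 2)
      simpa using h2
    refine tendsto_of_tendsto_of_tendsto_of_le_of_le' tendsto_const_nhds hu ?_ ?_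
    · filter_upwards [eventually_ge_atTop 1] with n hn
      have h2 := sqrt_mul_critScale_sq hn
      calc y ^ 2 / 2 = √n * critScale n ^ 2 * (y ^ 2 / 2) := by rw [h2, one_mul]
        _ = √n * ((critScale n * y) ^ 2 / 2) := by ring
        _ ≤ _ := by gcongr; exact sq_div_two_le_cosh_sub_one _
    · filter_upwards [eventually_ge_atTop 1] with n hn
      have h2 := sqrt_mul_critScale_sq hn
      calc _ ≤ √n * ((critScale n * y) ^ 2 / 2 * Real.exp ((critScale n * y) ^ 2 / 2)) := by
            gcongr; exact cosh_sub_one_le _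
        _ = √n * critScale n ^ 2 * (y ^ 2 / 2 * Real.exp ((critScale n * y) ^ 2 / 2)) := by ring
        _ = _ := by rw [h2, one_mul]

theorem integral_rpow_mul_exp_quartic {q : ℝ} (hq : -1 < q) :
    ∫ y : ℝ, |y| ^ q * Real.exp (-(1 / 12) * y ^ 4)
      = (1 / 12 : ℝ) ^ (-(q + 1) / 4) / 2 * Real.Gamma ((q + 1) / 4) := by
  have h1 : ∀ y : ℝ, |y| ^ q * Real.exp (-(1 / 12) * y ^ 4)
      = (fun x : ℝ => x ^ q * Real.exp (-(1 / 12) * x ^ (4 : ℝ))) |y| := by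
    intro y
    have : |y| ^ (4 : ℝ) = y ^ 4 := by
      rw [show (4 : ℝ) = ((4 : ℕ) : ℝ) by norm_num, Real.rpow_natCast,
        Even.pow_abs (by decide)]
    simp only [this]
  simp only [h1]
  rw [integral_comp_abs (f := fun x : ℝ => x ^ q * Real.exp (-(1 / 12) * x ^ (4 : ℝ))),
    integral_rpow_mul_exp_neg_mul_rpow (by norm_num) hq (by norm_num)]
  ring

theorem integral_exp_quartic : ∫ y : ℝ, Real.exp (-(1 / 12) * y ^ 4)
    = (12 : ℝ) ^ (1 / 4 : ℝ) / 2 * Real.Gamma (1 / 4) := by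
  have h := integral_rpow_mul_exp_quartic (q := 0) (by norm_num)
  simp only [Real.rpow_zero, one_mul] at h
  rw [h, one_div (12 : ℝ), Real.inv_rpow (by norm_num), ← Real.rpow_neg (by norm_num)]
  norm_num

theorem integral_sq_mul_exp_quartic : ∫ y : ℝ, y ^ 2 / 2 * Real.exp (-(1 / 12) * y ^ 4)
    = (12 : ℝ) ^ (3 / 4 : ℝ) / 4 * Real.Gamma (3 / 4) := by
  have h := integral_rpow_mul_exp_quartic (q := 2) (by norm_num)
  have e : ∀ y : ℝ, y ^ 2 / 2 * Real.exp (-(1 / 12) * y ^ 4)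
      = 1 / 2 * (|y| ^ (2 : ℝ) * Real.exp (-(1 / 12) * y ^ 4)) := by
    intro y
    rw [show |y| ^ (2 : ℝ) = y ^ 2 by
      rw [show (2 : ℝ) = ((2 : ℕ) : ℝ) by norm_num, Real.rpow_natCast, sq_abs]]
    ring
  simp only [e, MeasureTheory.integral_const_mul]
  rw [h, one_div (12 : ℝ), Real.inv_rpow (by norm_num), ← Real.rpow_neg (by norm_num)]
  norm_num
  ring

theorem critical_constant :
    √(2 / Real.pi) * ((12 : ℝ) ^ (3 / 4 : ℝ) / 4 * Real.Gamma (3 / 4)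
      / ((12 : ℝ) ^ (1 / 4 : ℝ) / 2 * Real.Gamma (1 / 4)))
      = 2 * √3 * √Real.pi / Real.Gamma (1 / 4) ^ 2 := by
  have hG : 0 < Real.Gamma (1 / 4) := Real.Gamma_pos_of_pos (by norm_num)
  have hp := Real.pi_pos
  have h1 := Real.Gamma_mul_Gamma_one_sub (1 / 4)
  rw [show (1 : ℝ) - 1 / 4 = 3 / 4 by norm_num, show Real.pi * (1 / 4) = Real.pi / 4 by ring,
    Real.sin_pi_div_four] at h1
  have h2 : Real.Gamma (3 / 4) = Real.pi * √2 / Real.Gamma (1 / 4) := by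
    rw [eq_div_iff hG.ne', mul_comm, h1]
    field_simp
    rw [Real.sq_sqrt (by norm_num)]
  have h3 : (12 : ℝ) ^ (3 / 4 : ℝ) = (12 : ℝ) ^ (1 / 4 : ℝ) * (2 * √3) := by
    have : 2 * √3 = (12 : ℝ) ^ (1 / 2 : ℝ) := by
      rw [← Real.sqrt_eq_rpow, show (12 : ℝ) = 2 ^ 2 * 3 by norm_num,
        Real.sqrt_mul (by norm_num), Real.sqrt_sq (by norm_num)]
    rw [this, ← Real.rpow_add (by norm_num)]
    norm_num
  have h4 : 0 < (12 : ℝ) ^ (1 / 4 : ℝ) := Real.rpow_pos_of_pos (by norm_num) _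
  have h5 : √(2 / Real.pi) = √2 * √Real.pi / Real.pi := by
    rw [Real.sqrt_div (by norm_num), div_eq_div_iff (by positivity) hp.ne', mul_assoc,
      Real.mul_self_sqrt hp.le]
  have h6 : √2 * √2 = (2 : ℝ) := Real.mul_self_sqrt (by norm_num)
  rw [h2, h3, h5]
  field_simp
  linear_combination 2 * h6

theorem gibbsMean_critical_eq {n : ℕ} (hn : 1 ≤ n) (g : ℝ → ℝ) :
    gibbsMean (rate 1 0) n g
      = (∫ y, g (critScale n * y) * critWeight n y) / ∫ y, critWeight n y :=
  (gibbsMean_comp_mul (rate 1 0) n g (critScale_pos hn)).symm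

theorem integral_critWeight_limit_pos : 0 < ∫ y : ℝ, Real.exp (-(1 / 12) * y ^ 4) := by
  rw [integral_exp_quartic]
  have := Real.Gamma_pos_of_pos (by norm_num : (0 : ℝ) < 1 / 4)
  positivity

theorem integrable_mul_critWeight {n : ℕ} (hn : 1 ≤ n) {g : ℝ → ℝ} {A C : ℝ} (hg : Continuous g)
    (hgb : ∀ y, |g y| ≤ C * Real.exp (A * |y|)) :
    MeasureTheory.Integrable fun y => g y * critWeight n y := by
  have hc := continuous_critWeight n
  refine ((integrable_critBound A).const_mul C).mono' (by fun_prop)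
    (Eventually.of_forall fun y => ?_)
  have hw : 0 < critWeight n y := Real.exp_pos _
  rw [Real.norm_eq_abs, abs_mul, abs_of_pos hw, ← mul_assoc]
  exact mul_le_mul (hgb y) (critWeight_le hn y) hw.le ((abs_nonneg _).trans (hgb y))

/-- At criticality `√n (E cosh t - 1)` converges to half of the second moment of the density
proportional to `exp (-y⁴ / 12)`. -/
theorem tendsto_gibbsMean_critical :
    Tendsto (fun n : ℕ => √(2 / Real.pi) * (√n * (gibbsMean (rate 1 0) n Real.cosh - 1))) atTop
      (𝓝 (2 * √3 * √Real.pi / Real.Gamma (1 / 4) ^ 2)) := by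
  rw [← critical_constant, ← integral_sq_mul_exp_quartic, ← integral_exp_quartic]
  have h := (tendsto_integral_cosh_critWeight.div tendsto_integral_critWeight
    integral_critWeight_limit_pos.ne').const_mul (√(2 / Real.pi))
  refine h.congr' ?_
  filter_upwards [eventually_ge_atTop 1] with n hn
  have hZ : 0 < ∫ y, critWeight n y := by
    have := integrable_mul_critWeight hn (g := fun _ => 1) (A := 0) (C := 1) continuous_const
      (fun y => by simp)
    simp only [one_mul] at this
    exact MeasureTheory.integral_exp_pos this
  have i1 : MeasureTheory.Integrable fun y => Real.cosh (critScale n * y) * critWeight n y := by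
    have hcosh := Real.continuous_cosh
    refine integrable_mul_critWeight hn (A := 1) (C := 1) (by fun_prop) fun y => ?_
    have hr := critScale_pos hn
    rw [abs_of_pos (Real.cosh_pos _), one_mul, one_mul]
    refine (cosh_le_exp_abs _).trans (Real.exp_le_exp.2 ?_)
    rw [abs_mul, abs_of_pos hr]
    exact mul_le_of_le_one_left (abs_nonneg y) (critScale_le_one hn)
  have i2 : MeasureTheory.Integrable (critWeight n) := by
    simpa using integrable_mul_critWeight hn (g := fun _ => 1) (A := 0) (C := 1) continuous_const
      (fun y => by simp)
  have e : ∀ y, √n * (Real.cosh (critScale n * y) - 1) * critWeight n y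
      = √n * (Real.cosh (critScale n * y) * critWeight n y - critWeight n y) := fun y => by ring
  simp only [Pi.div_apply, e, MeasureTheory.integral_const_mul]
  rw [MeasureTheory.integral_sub i1 i2, gibbsMean_critical_eq hn]
  field_simp

theorem exists_gibbsMean_critical_exp_le : ∃ C : ℝ, ∀ᶠ n : ℕ in atTop,
    gibbsMean (rate 1 0) n (fun t => Real.exp (3 * |t|)) ≤ C := by
  have hZ := integral_critWeight_limit_pos
  set Z := ∫ y : ℝ, Real.exp (-(1 / 12) * y ^ 4)
  set B := ∫ y : ℝ, Real.exp (3 * |y|) * (Real.exp (1 / 12) * Real.exp (-(1 / 12) * (y - 0) ^ 2))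
  have hB : 0 ≤ B := MeasureTheory.integral_nonneg fun y => by positivity
  refine ⟨B / (Z / 2), ?_⟩
  filter_upwards [eventually_ge_atTop 1,
    tendsto_integral_critWeight.eventually_const_le (half_lt_self hZ)] with n hn hn2
  rw [gibbsMean_critical_eq hn]
  have hpt : ∀ y, Real.exp (3 * |critScale n * y|) ≤ Real.exp (3 * |y|) := fun y => by
    rw [Real.exp_le_exp, abs_mul, abs_of_pos (critScale_pos hn)]
    have := mul_le_of_le_one_left (abs_nonneg y) (critScale_le_one hn)
    linarith
  refine div_le_div₀ hB ?_ (by positivity) hn2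
  refine MeasureTheory.integral_mono ?_ (integrable_critBound 3) fun y =>
    mul_le_mul (hpt y) (critWeight_le hn y) (Real.exp_pos _).le (Real.exp_pos _).le
  refine integrable_mul_critWeight hn (A := 3) (C := 1) (by fun_prop) fun y => ?_
  rw [abs_of_pos (Real.exp_pos _), one_mul]
  exact hpt y

/-! ### The mean-field equation -/

/-- If `x ↦ tanh (b x + h)` lies above the diagonal somewhere on the positive half-line, then
`tanh (b x + h) = x` has a greatest solution, and it is positive. -/
theorem exists_isGreatest_tanh {b h x₀ : ℝ} (hx₀ : 0 < x₀) (hle : x₀ ≤ Real.tanh (b * x₀ + h)) :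
    ∃ z, IsGreatest {x : ℝ | Real.tanh (b * x + h) = x} z ∧ 0 < z := by
  have hcont : Continuous fun x => Real.tanh (b * x + h) :=
    continuous_tanh.comp (by fun_prop)
  have hclosed : IsClosed {x : ℝ | Real.tanh (b * x + h) = x} := isClosed_eq hcont continuous_id
  have hsub : {x : ℝ | Real.tanh (b * x + h) = x} ⊆ Set.Icc (-1) 1 := by
    intro x hx
    rw [← show Real.tanh (b * x + h) = x from hx]
    exact ⟨(Real.neg_one_lt_tanh _).le, (Real.tanh_lt_one _).le⟩
  have hx1 : x₀ ≤ 1 := hle.trans (Real.tanh_lt_one _).le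
  obtain ⟨y, hy, hy0⟩ := intermediate_value_Icc' hx1
    (f := fun x => Real.tanh (b * x + h) - x) (hcont.sub continuous_id).continuousOn
    (show (0 : ℝ) ∈ Set.Icc _ _ from
      ⟨sub_nonpos.2 (Real.tanh_lt_one _).le, sub_nonneg.2 hle⟩)
  have hyS : y ∈ {x : ℝ | Real.tanh (b * x + h) = x} := sub_eq_zero.1 hy0
  obtain ⟨z, hz⟩ := (isCompact_Icc.of_isClosed_subset hclosed hsub).exists_isGreatest ⟨y, hyS⟩
  exact ⟨z, hz, hx₀.trans_le (hy.1.trans (hz.2 hyS))⟩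

theorem exists_isGreatest_tanh_of_one_lt {b : ℝ} (hb : 1 < b) :
    ∃ z, IsGreatest {x : ℝ | Real.tanh (b * x) = x} z ∧ 0 < z := by
  have hb0 : 0 < b := by linarith
  have hq : 0 < 3 * (b - 1) / b ^ 3 := div_pos (by linarith) (by positivity)
  -- at this point the cubic lower bound `y - y³ / 3` of `tanh y`, `y = b x₀`, equals `x₀`
  set x₀ := √(3 * (b - 1) / b ^ 3) with hx
  have hx0 : 0 < x₀ := Real.sqrt_pos.2 hq
  have hx2 : x₀ ^ 2 = 3 * (b - 1) / b ^ 3 := Real.sq_sqrt hq.le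
  have h1 := self_sub_cube_le_tanh (t := b * x₀) (by positivity)
  have e : b * x₀ - (b * x₀) ^ 3 / 3 = x₀ := by
    have : (b * x₀) ^ 3 = b ^ 3 * x₀ ^ 2 * x₀ := by ring
    rw [this, hx2]
    field_simp
    ring
  rw [e] at h1
  simpa using exists_isGreatest_tanh (b := b) (h := 0) hx0 (by simpa using h1)

/-! ### Passage to the asymptotic statements -/

theorem βc_div {d : ℕ} (hd : 0 < d) (β : ℝ) : β / βc d = 2 * d * β := by
  have : (0 : ℝ) < d := by exact_mod_cast hd
  rw [βc]
  field_simp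

theorem rpow_neg_half (n : ℕ) : (n : ℝ) ^ (-(1 / 2) : ℝ) = 1 / √n := by
  rw [Real.rpow_neg (Nat.cast_nonneg n), ← Real.sqrt_eq_rpow, one_div]

theorem rpow_neg_three_halves (n : ℕ) : (n : ℝ) ^ (-(3 / 2) : ℝ) = 1 / (n * √n) := by
  rcases Nat.eq_zero_or_pos n with rfl | hn
  · rw [Nat.cast_zero, Real.zero_rpow (by norm_num)]; simp
  have h : (0 : ℝ) < n := by exact_mod_cast hn
  rw [show (-(3 / 2) : ℝ) = -(1 + 1 / 2) by norm_num, Real.rpow_neg h.le, Real.rpow_add h,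
    Real.rpow_one, ← Real.sqrt_eq_rpow, one_div]

theorem eventually_oddAtTop {p : ℕ → Prop}
    (hp : ∀ᶠ n in atTop, ∀ m : ℕ, 1 ≤ m → n = 2 * m + 1 → p n) :
    ∀ᶠ n in oddAtTop, p n := by
  rw [oddAtTop, eventually_inf_principal]
  filter_upwards [hp, eventually_ge_atTop 3] with n hn hn3 hodd
  obtain ⟨m, hm⟩ := hodd
  exact hn m (by omega) hm

theorem isBigO_of_exists_bound {d : ℕ} {β h κ : ℝ}
    (H : ∃ C : ℝ, ∀ m : ℕ, 1 ≤ m → |P d β h (2 * m + 1) - κ / √(2 * m + 1)| ≤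
      C / ((2 * m + 1) * √(2 * m + 1))) :
    (fun n : ℕ => P d β h n - κ * (n : ℝ) ^ (-(1 / 2) : ℝ))
      =O[oddAtTop] fun n : ℕ => (n : ℝ) ^ (-(3 / 2) : ℝ) := by
  obtain ⟨C, hC⟩ := H
  refine IsBigO.of_bound C (eventually_oddAtTop (Eventually.of_forall ?_))
  rintro n m hm rfl
  rw [rpow_neg_half, rpow_neg_three_halves, Real.norm_eq_abs, Real.norm_eq_abs,
    abs_of_nonneg (by positivity : (0 : ℝ) ≤ 1 / ((2 * m + 1 : ℕ) * √(2 * m + 1 : ℕ))),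
    mul_one_div, mul_one_div]
  push_cast
  exact hC m hm

/-- The field `h'` of the mixing density may differ from `h` by its sign. -/
theorem exists_bound_of_gibbsMean {d : ℕ} {β h h' c₀ : ℝ} (hb : 0 < 2 * d * β)
    (hh : |h| = |h'|)
    (h1 : ∃ D : ℝ, ∀ n : ℕ, 1 ≤ n → |gibbsMean (rate (2 * d * β) h') n Real.cosh - c₀| ≤ D / n)
    (h2 : ∃ C : ℝ, 0 < C ∧ ∀ n : ℕ, 1 ≤ n →
      gibbsMean (rate (2 * d * β) h') n (fun t => Real.exp (3 * |t|)) ≤ C) :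
    ∃ C : ℝ, ∀ m : ℕ, 1 ≤ m → |P d β h (2 * m + 1) - √(2 / Real.pi) * c₀ / √(2 * m + 1)| ≤
      C / ((2 * m + 1) * √(2 * m + 1)) := by
  obtain ⟨D, hD⟩ := h1
  obtain ⟨C₁, -, hC₁⟩ := h2
  obtain ⟨C, hC, H⟩ := exists_abs_gibbsMean_spinProb_sub_le
  refine ⟨C * C₁ + √(2 / Real.pi) * D, fun m hm => ?_⟩
  have hn : 1 ≤ 2 * m + 1 := by omega
  have k1 := H hb h m hm
  have k2 := hD _ hn
  have k3 := hC₁ _ hn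
  rw [gibbsMean_rate_abs _ h' _ Real.cosh_neg, ← hh,
    ← gibbsMean_rate_abs _ h _ Real.cosh_neg] at k2
  rw [gibbsMean_rate_abs _ h' _ (fun t => by rw [abs_neg]), ← hh,
    ← gibbsMean_rate_abs _ h _ (fun t => by rw [abs_neg])] at k3
  rw [P_eq_gibbsMean hb]
  push_cast at k2
  set N : ℝ := 2 * m + 1 with hN
  have hN0 : 0 < N := by positivity
  set E := gibbsMean (rate (2 * d * β) h) (2 * m + 1) Real.cosh
  set Q := gibbsMean (rate (2 * d * β) h) (2 * m + 1) (spinProb m)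
  have e : Q - √(2 / Real.pi) * c₀ / √N
      = (Q - √(2 / Real.pi) / √N * E) + √(2 / Real.pi) / √N * (E - c₀) := by ring
  rw [e]
  refine (abs_add_le _ _).trans ?_
  rw [abs_mul, abs_of_nonneg (by positivity : 0 ≤ √(2 / Real.pi) / √N)]
  calc _ ≤ C / (N * √N) * C₁ + √(2 / Real.pi) / √N * (D / N) :=
        add_le_add (k1.trans (mul_le_mul_of_nonneg_left k3 (by positivity)))
          (mul_le_mul_of_nonneg_left k2 (by positivity))
    _ = _ := by field_simp

theorem exists_bound_of_beta_zero (d : ℕ) (h : ℝ) :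
    ∃ C : ℝ, ∀ m : ℕ, 1 ≤ m →
      |P d 0 h (2 * m + 1) - √(2 / Real.pi) * Real.cosh h / √(2 * m + 1)| ≤
      C / ((2 * m + 1) * √(2 * m + 1)) := by
  obtain ⟨C, -, H⟩ := exists_abs_spinProb_sub_le
  refine ⟨C * Real.exp (3 * |h|), fun m hm => ?_⟩
  rw [P_eq_spinProb]
  exact H m hm h

theorem high_temperature {d : ℕ} (hd : 0 < d) {β : ℝ} (hβ : 0 ≤ β) (hβc : β < βc d) :
    (fun n : ℕ => P d β 0 n - √(2 / Real.pi) * (n : ℝ) ^ (-(1 / 2) : ℝ))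
      =O[oddAtTop] fun n : ℕ => (n : ℝ) ^ (-(3 / 2) : ℝ) := by
  have hd0 : (0 : ℝ) < d := by exact_mod_cast hd
  refine isBigO_of_exists_bound ?_
  rcases hβ.eq_or_lt with rfl | hβ
  · simpa using exists_bound_of_beta_zero d 0
  have hb : 0 < 2 * d * β := by positivity
  have hb1 : 2 * d * β < 1 := by
    rw [βc, lt_div_iff₀ (by positivity)] at hβc
    linarith
  simpa using exists_bound_of_gibbsMean (h := 0) (h' := 0) hb rfl
    (exists_abs_gibbsMean_cosh_sub_one_le hb hb1)
    (exists_gibbsMean_rate_exp_le (quadraticWell_rate_zero hb hb1) 3)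

theorem critical_temperature {d : ℕ} (hd : 0 < d) {β : ℝ} (hβ : β = βc d) :
    (fun n : ℕ => P d β 0 n - (√(2 / Real.pi) * (n : ℝ) ^ (-(1 / 2) : ℝ) +
        2 * √3 * √Real.pi / Real.Gamma (1 / 4) ^ 2 * (n : ℝ) ^ (-1 : ℝ)))
      =o[oddAtTop] fun n : ℕ => (n : ℝ) ^ (-1 : ℝ) := by
  have hd0 : (0 : ℝ) < d := by exact_mod_cast hd
  have hb1 : 2 * d * β = 1 := by
    rw [hβ, βc]; field_simp
  have hle : oddAtTop ≤ atTop := inf_le_left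
  obtain ⟨C, hC, H⟩ := exists_abs_gibbsMean_spinProb_sub_le
  obtain ⟨C₁, hC₁⟩ := exists_gibbsMean_critical_exp_le
  set κ := 2 * √3 * √Real.pi / Real.Gamma (1 / 4) ^ 2
  set E : ℕ → ℝ := fun n => gibbsMean (rate 1 0) n Real.cosh with hE
  have hpos : ∀ᶠ n : ℕ in oddAtTop, 1 ≤ n := hle (eventually_ge_atTop 1)
  have h1 : Tendsto (fun n : ℕ => n * (P d β 0 n - √(2 / Real.pi) / √n * E n)) oddAtTop (𝓝 0) := by
    have hz : Tendsto (fun n : ℕ => C * C₁ / √n) oddAtTop (𝓝 0) :=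
      ((tendsto_const_nhds.div_atTop
        (Real.tendsto_sqrt_atTop.comp tendsto_natCast_atTop_atTop))).mono_left hle
    refine squeeze_zero_norm' (eventually_oddAtTop ?_) hz
    filter_upwards [hC₁] with n hn m hm hnm
    subst hnm
    have k1 := H one_pos 0 m hm
    have k2 := P_eq_gibbsMean (d := d) (β := β) (by rw [hb1]; exact one_pos) 0 m
    rw [hb1] at k2
    rw [← k2] at k1
    rw [Real.norm_eq_abs, abs_mul, Nat.abs_cast]
    push_cast
    set N : ℝ := 2 * m + 1 with hN
    have hN0 : 0 < N := by positivity
    calc _ ≤ N * (C / (N * √N) * C₁) := by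
          refine mul_le_mul_of_nonneg_left (k1.trans ?_) hN0.le
          exact mul_le_mul_of_nonneg_left hn (by positivity)
      _ = _ := by field_simp
  have h2 := h1.add (tendsto_gibbsMean_critical.mono_left hle)
  have h3 := h2.sub_const κ
  rw [zero_add, sub_self] at h3
  refine (isLittleO_iff_tendsto' ?_).2 (h3.congr' ?_)
  · filter_upwards [hpos] with n hn h0
    have : (0 : ℝ) < n := by exact_mod_cast hn
    exact absurd h0 (Real.rpow_pos_of_pos this _).ne'
  · filter_upwards [hpos] with n hn
    have hn0 : (0 : ℝ) < n := by exact_mod_cast hn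
    have hs : √n * √n = (n : ℝ) := Real.mul_self_sqrt hn0.le
    have hs0 : 0 < √(n : ℝ) := Real.sqrt_pos.2 hn0
    have e1 : (n : ℝ) * (√(2 / Real.pi) / √n) = √(2 / Real.pi) * √n := by
      field_simp
      rw [sq, hs]
    rw [rpow_neg_half, Real.rpow_neg_one, div_inv_eq_mul]
    have e2 : (n : ℝ)⁻¹ * n = 1 := inv_mul_cancel₀ hn0.ne'
    linear_combination (1 - E n) * e1 + κ * e2

theorem low_temperature {d : ℕ} (hd : 0 < d) {β : ℝ} (hβ : βc d < β) :
    ∃ z t : ℝ, IsGreatest {x : ℝ | Real.tanh (β / βc d * x) = x} z ∧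
      t = 2 * (d : ℝ) * β * z ∧
      (fun n : ℕ => P d β 0 n - √(2 / Real.pi) * Real.cosh t * (n : ℝ) ^ (-(1 / 2) : ℝ))
        =O[oddAtTop] fun n : ℕ => (n : ℝ) ^ (-(3 / 2) : ℝ) := by
  have hd0 : (0 : ℝ) < d := by exact_mod_cast hd
  rw [βc_div hd]
  have hb1 : 1 < 2 * d * β := by
    rw [βc, div_lt_iff₀ (by positivity)] at hβ
    linarith
  have hb : 0 < 2 * d * β := by linarith
  obtain ⟨z, hz, hz0⟩ := exists_isGreatest_tanh_of_one_lt hb1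
  refine ⟨z, 2 * d * β * z, hz, rfl, isBigO_of_exists_bound ?_⟩
  have ha : 0 < 2 * d * β * z := by positivity
  have hab : 2 * d * β * z / (2 * d * β) = Real.tanh (2 * d * β * z) := by
    rw [mul_div_cancel_left₀ _ hb.ne']
    exact (show Real.tanh (2 * d * β * z) = z from hz.1).symm
  have hab' : (2 * d * β * z - 0) / (2 * d * β) = Real.tanh (2 * d * β * z) := by
    rw [sub_zero, hab]
  obtain ⟨c, hc, H⟩ := exists_rate_sub_ge hb ha hab'
  exact exists_bound_of_gibbsMean hb rfl (exists_abs_gibbsMean_cosh_sub_le_of_zero hb ha hab)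
    (exists_gibbsMean_rate_exp_le (quadraticWell_rate hb le_rfl ha hc hab' H) 3)

theorem nonzero_field {d : ℕ} (hd : 0 < d) {β h : ℝ} (hβ : 0 ≤ β) (hh : h ≠ 0) :
    ∃ z t : ℝ, IsGreatest {x : ℝ | Real.tanh (β / βc d * x + |h|) = x} z ∧
      t = 2 * (d : ℝ) * β * z + |h| ∧
      (fun n : ℕ => P d β h n - √(2 / Real.pi) * Real.cosh t * (n : ℝ) ^ (-(1 / 2) : ℝ))
        =O[oddAtTop] fun n : ℕ => (n : ℝ) ^ (-(3 / 2) : ℝ) := by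
  have hd0 : (0 : ℝ) < d := by exact_mod_cast hd
  have hh0 : 0 < |h| := abs_pos.2 hh
  rw [βc_div hd]
  have hT : 0 < Real.tanh |h| := by
    have := mul_sech_sq_lt_tanh hh0
    have := mul_pos hh0 (one_sub_tanh_sq_pos |h|)
    linarith
  have hT2 : 0 ≤ 2 * d * β * Real.tanh |h| := by positivity
  obtain ⟨z, hz, hz0⟩ := exists_isGreatest_tanh (b := 2 * d * β) (h := |h|) hT
    (tanh_mono (by linarith))
  refine ⟨z, 2 * d * β * z + |h|, hz, rfl, isBigO_of_exists_bound ?_⟩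
  rcases hβ.eq_or_lt with rfl | hβ
  · simpa using exists_bound_of_beta_zero d h
  have hb : 0 < 2 * d * β := by positivity
  have ha : 0 < 2 * d * β * z + |h| := by positivity
  have hab : (2 * d * β * z + |h| - |h|) / (2 * d * β) = Real.tanh (2 * d * β * z + |h|) := by
    rw [add_sub_cancel_right, mul_div_cancel_left₀ _ hb.ne']
    exact (show Real.tanh (2 * d * β * z + |h|) = z from hz.1).symm
  obtain ⟨c, hc, H⟩ := exists_rate_sub_ge hb ha hab
  exact exists_bound_of_gibbsMean (h' := |h|) hb (abs_abs h).symm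
    (exists_abs_gibbsMean_cosh_sub_le_of_pos hb hh0 ha hab)
    (exists_gibbsMean_rate_exp_le (quadraticWell_rate hb hh0.le ha hc hab H) 3)

end CurieWeiss

theorem proposition5 (d : ℕ) (hd : 0 < d) (β h : ℝ) (hβ : 0 ≤ β) :
    -- high temperature
    (h = 0 → β < CurieWeiss.βc d →
      (fun n : ℕ => CurieWeiss.P d β h n - √(2 / Real.pi) * (n : ℝ) ^ (-(1 / 2) : ℝ))
        =O[CurieWeiss.oddAtTop] fun n : ℕ => (n : ℝ) ^ (-(3 / 2) : ℝ)) ∧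
    -- criticality
    (h = 0 → β = CurieWeiss.βc d →
      (fun n : ℕ => CurieWeiss.P d β h n -
          (√(2 / Real.pi) * (n : ℝ) ^ (-(1 / 2) : ℝ) +
            2 * √3 * √Real.pi / Real.Gamma (1 / 4) ^ 2 * (n : ℝ) ^ (-1 : ℝ)))
        =o[CurieWeiss.oddAtTop] fun n : ℕ => (n : ℝ) ^ (-1 : ℝ)) ∧
    -- low temperature
    (h = 0 → CurieWeiss.βc d < β →
      ∃ z t : ℝ, IsGreatest {x : ℝ | Real.tanh (β / CurieWeiss.βc d * x) = x} z ∧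
        t = 2 * (d : ℝ) * β * z ∧
        (fun n : ℕ => CurieWeiss.P d β h n -
            √(2 / Real.pi) * Real.cosh t * (n : ℝ) ^ (-(1 / 2) : ℝ))
          =O[CurieWeiss.oddAtTop] fun n : ℕ => (n : ℝ) ^ (-(3 / 2) : ℝ)) ∧
    -- nonzero field
    (h ≠ 0 →
      ∃ z t : ℝ, IsGreatest {x : ℝ | Real.tanh (β / CurieWeiss.βc d * x + |h|) = x} z ∧
        t = 2 * (d : ℝ) * β * z + |h| ∧
        (fun n : ℕ => CurieWeiss.P d β h n -
            √(2 / Real.pi) * Real.cosh t * (n : ℝ) ^ (-(1 / 2) : ℝ))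
          =O[CurieWeiss.oddAtTop] fun n : ℕ => (n : ℝ) ^ (-(3 / 2) : ℝ)) := by
  refine ⟨?_, ?_, ?_, fun hh => CurieWeiss.nonzero_field hd hβ hh⟩
  · rintro rfl hlt
    exact CurieWeiss.high_temperature hd hβ hlt
  · rintro rfl heq
    exact CurieWeiss.critical_temperature hd heq
  · rintro rfl hlt
    exact CurieWeiss.low_temperature hd hlt
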